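/- Let $(\epsilon_n)_{n\ge 1}$ be any sequence of positive numbers with $\epsilon_n\to 0$. Then there exist a weight $w$, i.e. a function $w\in L^1(\mathbb{R})$ with $w(x)>0$ for almost every $x$, and a sequence $\Lambda=\{\lambda_n\}_{n\ge1}$ of positive real numbers that is uniformly discrete, i.e. $\inf_{m\ne n}|\lambda_m-\lambda_n|>0$, such that (i) $\dfrac{\lambda_{n+1}}{\lambda_n}>1+\epsilon_n$ for every $n$; (ii) the system of exponentials $E(\Lambda)=\{e^{i\lambda x}\}_{\lambda\in\Lambda}$ is a $(QF)$-system in the weighted space $L^2_w(\mathbb{R})$ of complex functions $f$ with $\int_{\mathbb{R}}|f(x)|^2w(x)\,dx<\infty$, with scalar product $\langle f,g\rangle=\int_{\mathbb{R}} f(x)\overline{g(x)}\,w(x)\,dx$. Here a system of vectors $\{u_n\}$ in a Hilbert space $H$ is called a $(QF)$-system if the following two conditions hold: (a) for every $q>2$ there is a constant $C(q)$ such that for every $f\in H$ and every $\epsilon>0$ there is a finite linear combination $Q=\sum c_nu_n$ with $\|f-Q\|<\epsilon$ and $\left(\sum|c_n|^q\right)^{1/q}\le C(q)\,\|f\|$;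 (b) (Bessel inequality) there is a constant $C'$ such that $\left(\sum|\langle f,u_n\rangle|^2\right)^{1/2}\le C'\|f\|$ for all $f\in H$. -/

import Mathlib

open MeasureTheory Filter Topology

/-- A set of real numbers is uniformly discrete if its distinct points are separated by some
`δ > 0`. -/
def UniformlyDiscrete (S : Set ℝ) : Prop :=
  ∃ δ : ℝ, 0 < δ ∧ ∀ x ∈ S, ∀ y ∈ S, x ≠ y → δ ≤ |x - y|

/-- `(QF)`-systems in a complex Hilbert space: (i) completeness with `ℓ_q` estimate of the
coefficients for every `q > 2`; (ii) the Bessel inequality. -/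
def IsQFSystem {ι H : Type*} [NormedAddCommGroup H] [InnerProductSpace ℂ H] (u : ι → H) : Prop :=
  (∀ q : ℝ, 2 < q → ∃ C : ℝ, ∀ f : H, ∀ ε : ℝ, 0 < ε → ∃ c : ι →₀ ℂ,
      ‖f - ∑ n ∈ c.support, c n • u n‖ < ε ∧
      (∑ n ∈ c.support, ‖c n‖ ^ q) ^ (1 / q) ≤ C * ‖f‖) ∧
  (∃ C' : ℝ, ∀ f : H, Summable (fun n => ‖inner ℂ f (u n)‖ ^ 2) ∧
      Real.sqrt (∑' n, ‖inner ℂ f (u n)‖ ^ 2) ≤ C' * ‖f‖)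

/-- A weight: an integrable function on `ℝ` that is strictly positive almost everywhere. -/
structure IsWeight (w : ℝ → ℝ) : Prop where
  integrable : Integrable w volume
  pos : ∀ᵐ x ∂(volume : Measure ℝ), 0 < w x

/-- The measure `w(x) dx`. -/
noncomputable def weightMeasure (w : ℝ → ℝ) : Measure ℝ :=
  (volume : Measure ℝ).withDensity (fun x => ENNReal.ofReal (w x))

/-- The weighted space `L²_w(ℝ)` of complex functions, with its Hilbert space structure. -/
noncomputable abbrev WeightedL2 (w : ℝ → ℝ) : Type := Lp ℂ 2 (weightMeasure w)

theorem IsWeight.isFiniteMeasure {w : ℝ → ℝ} (hw : IsWeight w) :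
    IsFiniteMeasure (weightMeasure w) :=
  isFiniteMeasure_withDensity_ofReal hw.integrable.2

theorem IsWeight.memLp_exp {w : ℝ → ℝ} (hw : IsWeight w) (l : ℝ) :
    MemLp (fun x : ℝ => Complex.exp (Complex.I * (l : ℂ) * (x : ℂ))) 2 (weightMeasure w) := by
  haveI := hw.isFiniteMeasure
  refine MemLp.of_bound (C := 1) (Continuous.aestronglyMeasurable (by fun_prop)) ?_
  refine Eventually.of_forall fun x => ?_
  rw [Complex.norm_exp]
  simp

/-- The exponential `x ↦ e^{i l x}` as an element of `L²_w(ℝ)`. -/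
noncomputable def expL2 {w : ℝ → ℝ} (hw : IsWeight w) (l : ℝ) : WeightedL2 w :=
  (hw.memLp_exp l).toLp (fun x : ℝ => Complex.exp (Complex.I * (l : ℂ) * (x : ℂ)))

/-! Every f in L²_w turns out to be a limit of combinations of exponentials taken arbitrarily far
out in Λ, with coefficients of arbitrarily small ℓ_q norm for each q > 2 (`SmallCoeffApprox`);
condition (a) then holds with C(q) = 1. This property passes to linear combinations and to limits,
so it suffices to check it on e^{2πiσx} for σ in a countable dense set.

The core is `exists_polynomial_close_one_small_coeff`: polynomials P_k with P_k(0) = 0, small ℓ_p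
norm of coefficients for exponents p = p_k decreasing to 2, and P_k close to 1 on the circle outside
a set of measure below 2^{-k}. (Such P_k have mean zero, so closeness holds in measure, never in
L².) Then e^{2πiσx} ≈ e^{2πiσx} P_k(e^{2πiLx}), whose frequencies form a finite arithmetic
progression σ + Lj, j ≥ 1. A progression of fixed length with large L has ratios above 1 + ε_n once
it is placed where ε_n is small compared with the inverse length; this yields Λ
(`exists_block_sequence`).

The exceptional sets have summable measures, so by Borel–Cantelli a Gaussian can be damped on them
as strongly as desired and remain positive almost everywhere (`exists_isWeight_small`). Staying
below the Gaussian also gives the Bessel inequality: for separated frequencies the Gaussian Gram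
matrix decays fast away from the diagonal (`exists_bessel_bound`). -/

/-! ### Polynomials without constant term close to 1 in measure -/

/-- Arithmetic means of the partial sums of the geometric series. -/
noncomputable def geomMean (n : ℕ) : Polynomial ℂ :=
  Polynomial.C ((n : ℂ)⁻¹) * ∑ t ∈ Finset.range n, ∑ j ∈ Finset.range (t + 1), Polynomial.X ^ j

theorem geomMean_eval_zero {n : ℕ} (hn : 0 < n) : (geomMean n).eval 0 = 1 := by
  have hn' : (n : ℂ) ≠ 0 := by exact_mod_cast hn.ne'
  simp [geomMean, Polynomial.eval_finsetSum, Finset.sum_range_succ', hn']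

/-- The error is exactly z(zⁿ - 1) / (n(z - 1)²): the geometric series is Cesàro summable on the
circle, uniformly away from 1. -/
theorem norm_geomMean_sub_le {n : ℕ} (hn : 0 < n) {z : ℂ} (hz : ‖z‖ = 1) (hz1 : z ≠ 1) :
    ‖(geomMean n).eval z - (1 - z)⁻¹‖ ≤ 2 / (n * ‖z - 1‖ ^ 2) := by
  have hn' : (n : ℂ) ≠ 0 := by exact_mod_cast hn.ne'
  have h1 : z - 1 ≠ 0 := sub_ne_zero.2 hz1
  have h2 : 1 - z ≠ 0 := sub_ne_zero.2 hz1.symm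
  have key : (geomMean n).eval z - (1 - z)⁻¹ = z * (z ^ n - 1) / (n * (z - 1) ^ 2) := by
    have e1 : (geomMean n).eval z
        = (n : ℂ)⁻¹ * ∑ t ∈ Finset.range n, (z * z ^ t - 1) / (z - 1) := by
      simp only [geomMean, Polynomial.eval_mul, Polynomial.eval_C, Polynomial.eval_finsetSum,
        Polynomial.eval_pow, Polynomial.eval_X]
      congr 1
      refine Finset.sum_congr rfl fun t _ => ?_
      rw [geom_sum_eq hz1, pow_succ']
    rw [e1, ← Finset.sum_div, Finset.sum_sub_distrib, ← Finset.mul_sum, geom_sum_eq hz1]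
    simp only [Finset.sum_const, Finset.card_range, nsmul_eq_mul, mul_one]
    have h3 : (1 - z)⁻¹ = -(z - 1)⁻¹ := by rw [← neg_sub, inv_neg]
    rw [h3]
    field_simp
    ring
  have hnum : ‖z ^ n - 1‖ ≤ 2 := by
    refine (norm_sub_le _ _).trans ?_
    simp [hz]; norm_num
  rw [key, norm_div, norm_mul, norm_mul, hz, norm_pow, Complex.norm_natCast, one_mul]
  gcongr

/-- The Möbius map z ↦ 1/(1 - z) carries the unit circle to the line Re = 1/2. -/
theorem re_inv_one_sub {z : ℂ} (hz : ‖z‖ = 1) (hz1 : z ≠ 1) : ((1 - z)⁻¹).re = 1 / 2 := by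
  have h2 : Complex.normSq (1 - z) ≠ 0 := by
    simpa [Complex.normSq_eq_zero, sub_eq_zero] using hz1.symm
  have h3 : Complex.normSq z = 1 := by rw [Complex.normSq_eq_norm_sq, hz]; norm_num
  rw [Complex.inv_re]
  rw [div_eq_iff h2]
  simp only [Complex.normSq_apply, Complex.sub_re, Complex.sub_im, Complex.one_re,
    Complex.one_im] at *
  linarith

/-- A polynomial vanishing at the origin whose real part is at least `1 / 4` on the unit circle
outside a neighbourhood of `1`. -/
theorem exists_polynomial_re_ge {ρ : ℝ} (hρ : 0 < ρ) :
    ∃ h : Polynomial ℂ, h.eval 0 = 0 ∧ ∀ z : ℂ, ‖z‖ = 1 → ρ ≤ ‖z - 1‖ → 1 / 4 ≤ (h.eval z).re := by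
  -- On the circle Re(1 - 1/(1 - z)) = 1/2; this n brings the Cesàro error 2/(nρ²) below 1/4.
  obtain ⟨n, hn⟩ := exists_nat_gt (8 / ρ ^ 2)
  have hn0 : (0 : ℝ) < n := lt_of_le_of_lt (by positivity) hn
  have hn1 : 0 < n := by exact_mod_cast hn0
  refine ⟨1 - geomMean n, by simp [geomMean_eval_zero hn1], fun z hz hz1 => ?_⟩
  have hne : z ≠ 1 := by
    rintro rfl
    simp at hz1
    linarith
  have h1 := norm_geomMean_sub_le hn1 hz hne
  have hz0 : 0 < ‖z - 1‖ := hρ.trans_le hz1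
  have h2 : 2 / (n * ‖z - 1‖ ^ 2) ≤ 1 / 4 := by
    rw [div_le_iff₀ (by positivity)]
    rw [div_lt_iff₀ (by positivity)] at hn
    have : ρ ^ 2 ≤ ‖z - 1‖ ^ 2 := by gcongr
    nlinarith
  have h3 := (Complex.abs_re_le_norm _).trans (h1.trans h2)
  rw [Complex.sub_re, re_inv_one_sub hz hne, abs_le] at h3
  simp only [Polynomial.eval_sub, Polynomial.eval_one, Complex.sub_re, Complex.one_re]
  linarith [h3.2]

theorem exists_exp_taylor_close (B : ℝ) {δ : ℝ} (hδ : 0 < δ) :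
    ∃ N : ℕ, 0 < N ∧ ∀ w : ℂ, ‖w‖ ≤ B →
      ‖Complex.exp w - ∑ n ∈ Finset.range N, w ^ n / n.factorial‖ ≤ δ := by
  have h1 := FloorSemiring.tendsto_pow_div_factorial_atTop (|B|)
  obtain ⟨N, h2, h3, h4⟩ := ((h1.eventually (gt_mem_nhds (half_pos hδ))).and
    ((eventually_gt_atTop 0).and (eventually_ge_atTop ⌈2 * |B|⌉₊))).exists
  refine ⟨N, h3, fun w hw => ?_⟩
  have hw' : ‖w‖ ≤ |B| := hw.trans (le_abs_self B)
  have h5 : 2 * |B| ≤ N := (Nat.le_ceil _).trans (by exact_mod_cast h4)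
  have h6 : ‖w‖ / (N.succ : ℝ) ≤ 1 / 2 := by
    rw [div_le_iff₀ (by positivity)]
    push_cast
    linarith
  refine (Complex.exp_bound' h6).trans ?_
  have : ‖w‖ ^ N / (N.factorial : ℝ) ≤ |B| ^ N / N.factorial := by gcongr
  linarith

theorem norm_fourier_apply {T : ℝ} (n : ℤ) (θ : AddCircle T) : ‖fourier n θ‖ = 1 := by
  rw [fourier_apply]; exact Circle.norm_coe _

theorem fourier_natCast_apply {T : ℝ} (n : ℕ) (θ : AddCircle T) :
    fourier (n : ℤ) θ = fourier 1 θ ^ n := by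
  induction n with
  | zero => simp
  | succ n ih => rw [Nat.cast_succ, fourier_add, ih, pow_succ]

theorem fourier_one_nsmul {T : ℝ} (n : ℕ) (θ : AddCircle T) :
    fourier 1 (n • θ) = fourier 1 θ ^ n := by
  rw [← fourier_natCast_apply, fourier_apply, fourier_apply, one_smul, natCast_zsmul]

/-- Continuity from above: these neighbourhoods shrink to the null set {0}. -/
theorem exists_measure_nhds_one_lt {η : ENNReal} (hη : 0 < η) :
    ∃ ρ : ℝ, 0 < ρ ∧ volume {θ : UnitAddCircle | ‖fourier 1 θ - 1‖ < ρ} < η := by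
  have hcont : Continuous fun θ : UnitAddCircle => ‖fourier 1 θ - 1‖ := by fun_prop
  have h0 : (⋂ n : ℕ, {θ : UnitAddCircle | ‖fourier 1 θ - 1‖ < 1 / ((n : ℝ) + 1)}) = {0} := by
    ext θ
    simp only [Set.mem_iInter, Set.mem_ofPred_eq, Set.mem_singleton_iff]
    refine ⟨fun h => ?_, fun h n => by rw [h]; simp; positivity⟩
    have h1 : ‖fourier 1 θ - 1‖ ≤ 0 :=
      ge_of_tendsto' tendsto_one_div_add_atTop_nhds_zero_nat fun n => (h n).le
    have h2 : fourier 1 θ = 1 := by simpa [sub_eq_zero] using h1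
    rw [fourier_one] at h2
    apply AddCircle.injective_toCircle one_ne_zero
    rw [AddCircle.toCircle_zero]
    exact Circle.ext (by simpa using h2)
  have h1 := tendsto_measure_iInter_atTop (μ := (volume : Measure UnitAddCircle))
    (s := fun n : ℕ => {θ : UnitAddCircle | ‖fourier 1 θ - 1‖ < 1 / ((n : ℝ) + 1)})
    (fun n => (measurableSet_lt hcont.measurable measurable_const).nullMeasurableSet)
    (fun m n hmn θ hθ => lt_of_lt_of_le (Set.mem_ofPred.1 hθ) (Nat.one_div_le_one_div hmn))
    ⟨0, measure_ne_top _ _⟩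
  have h2 : volume ({0} : Set UnitAddCircle) = 0 := by
    rw [← Metric.closedBall_zero, AddCircle.volume_closedBall]
    simp
  rw [h0, h2] at h1
  obtain ⟨n, hn⟩ := (h1.eventually (gt_mem_nhds hη)).exists
  exact ⟨1 / ((n : ℝ) + 1), by positivity, hn⟩

theorem exists_norm_eval_le (P : Polynomial ℂ) : ∃ A : ℝ, 1 ≤ A ∧ ∀ z : ℂ, ‖z‖ = 1 → ‖P.eval z‖ ≤ A := by
  have hK : IsCompact (Metric.sphere (0 : ℂ) 1) := isCompact_sphere _ _
  obtain ⟨A, hA⟩ := hK.exists_bound_of_continuousOn P.continuous.continuousOn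
  exact ⟨max A 1, le_max_right _ _, fun z hz => (hA z (by simpa using hz)).trans (le_max_left _ _)⟩

/-- Polynomials without constant term approximate `1` in measure on the unit circle. -/
theorem exists_polynomial_close_one {δ : ℝ} (hδ : 0 < δ) :
    ∃ P : Polynomial ℂ, P.coeff 0 = 0 ∧
      volume {θ : UnitAddCircle | δ < ‖P.eval (fourier 1 θ) - 1‖} < ENNReal.ofReal δ := by
  obtain ⟨ρ, hρ, hvol⟩ := exists_measure_nhds_one_lt (ENNReal.ofReal_pos.2 hδ)
  obtain ⟨h, h0, hre⟩ := exists_polynomial_re_ge hρ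
  obtain ⟨B, hB1, hB⟩ := exists_norm_eval_le h
  -- This is e^{-a/4} < δ/2, with 1/4 the lower bound of Re h away from 1.
  obtain ⟨a, ha⟩ := exists_nat_gt (-(4 * Real.log (δ / 2)))
  obtain ⟨N, hN, hexp⟩ := exists_exp_taylor_close (a * B) (half_pos hδ)
  -- One minus a Taylor polynomial of exp evaluated at -a h. Since h(0) = 0 and N > 0, P vanishes at
  -- 0; away from 1 on the circle exp(-a h) is small, so P is close to 1.
  set P : Polynomial ℂ := 1 - ∑ n ∈ Finset.range N,
    Polynomial.C ((n.factorial : ℂ)⁻¹) * (-(Polynomial.C (a : ℂ)) * h) ^ n with hP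
  have heval : ∀ z, P.eval z - 1
      = -∑ n ∈ Finset.range N, (-(a * h.eval z)) ^ n / (n.factorial : ℂ) := by
    intro z
    simp only [hP, Polynomial.eval_sub, Polynomial.eval_one, Polynomial.eval_finsetSum,
      Polynomial.eval_mul, Polynomial.eval_C, Polynomial.eval_pow, Polynomial.eval_neg]
    rw [sub_sub_cancel_left]
    congr 1
    refine Finset.sum_congr rfl fun n _ => ?_
    rw [div_eq_mul_inv, mul_comm, neg_mul]
  refine ⟨P, ?_, lt_of_le_of_lt (measure_mono ?_) hvol⟩
  · rw [Polynomial.coeff_zero_eq_eval_zero]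
    have := heval 0
    rw [h0] at this
    obtain ⟨N, rfl⟩ := Nat.exists_eq_succ_of_ne_zero hN.ne'
    simp only [Nat.succ_eq_add_one, Finset.sum_range_succ', mul_zero, neg_zero] at this
    simpa [sub_eq_neg_self] using this
  · intro θ hθ
    simp only [Set.mem_ofPred_eq] at hθ ⊢
    by_contra! hc
    set z := fourier 1 θ with hz
    have hz1 : ‖z‖ = 1 := norm_fourier_apply 1 θ
    have h1 := hre z hz1 hc
    have h2 : ‖-((a : ℂ) * h.eval z)‖ ≤ a * B := by
      rw [norm_neg, norm_mul, Complex.norm_natCast]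
      have := hB z hz1
      gcongr
    have h3 := hexp _ h2
    have h4 : ‖Complex.exp (-((a : ℂ) * h.eval z))‖ ≤ δ / 2 := by
      rw [Complex.norm_exp, ← Real.le_log_iff_exp_le (half_pos hδ)]
      simp only [Complex.neg_re, Complex.mul_re, Complex.natCast_re, Complex.natCast_im, zero_mul,
        sub_zero]
      nlinarith [Nat.cast_nonneg (α := ℝ) a]
    rw [heval, norm_neg] at hθ
    have h5 := norm_sub_norm_le (∑ n ∈ Finset.range N, (-(a * h.eval z)) ^ n / (n.factorial : ℂ))
      (Complex.exp (-((a : ℂ) * h.eval z)))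
    rw [norm_sub_rev] at h5
    linarith

/-! ### Arcs of the circle and the maps θ ↦ Nθ -/

/-- The arc `(l / m, (l + 1) / m]` of the unit circle. -/
noncomputable def arc (m l : ℕ) : Set UnitAddCircle :=
  {θ | (AddCircle.measurableEquivIoc 1 0 θ : ℝ) ∈ Set.Ioc ((l : ℝ) / m) ((l + 1) / m)}

theorem measurableSet_arc (m l : ℕ) : MeasurableSet (arc m l) :=
  (measurable_subtype_coe.comp (AddCircle.measurableEquivIoc 1 0).measurable) measurableSet_Ioc

theorem coe_mem_arc {m l : ℕ} {x : ℝ} (hx : x ∈ Set.Ioc (0 : ℝ) 1) :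
    (x : UnitAddCircle) ∈ arc m l ↔ x ∈ Set.Ioc ((l : ℝ) / m) ((l + 1) / m) := by
  have hx' : x ∈ Set.Ioc (0 : ℝ) (0 + 1) := by simpa using hx
  have h : (AddCircle.measurableEquivIoc 1 0 (x : UnitAddCircle) : ℝ) = x := by
    change ((AddCircle.equivIoc 1 0 (x : UnitAddCircle)) : ℝ) = x
    rw [AddCircle.equivIoc_coe_eq hx']
  rw [arc, Set.mem_ofPred, h]

theorem arc_existsUnique {m : ℕ} (hm : 0 < m) (θ : UnitAddCircle) :
    ∃ l < m, θ ∈ arc m l ∧ ∀ l', θ ∈ arc m l' → l' = l := by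
  set x : ℝ := (AddCircle.measurableEquivIoc 1 0 θ : ℝ) with hx
  have hx0 : 0 < x := (AddCircle.measurableEquivIoc 1 0 θ).2.1
  have hx1 : x ≤ 1 := by simpa using (AddCircle.measurableEquivIoc 1 0 θ).2.2
  have hm' : (0 : ℝ) < m := by exact_mod_cast hm
  have hmem : ∀ l, θ ∈ arc m l ↔ ⌈x * m⌉₊ = l + 1 := by
    intro l
    rw [arc, Set.mem_ofPred, ← hx, Set.mem_Ioc, div_lt_iff₀ hm', le_div_iff₀ hm',
      Nat.ceil_eq_iff (by omega)]
    simp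
  have hpos : 0 < ⌈x * m⌉₊ := Nat.ceil_pos.2 (by positivity)
  have hle : ⌈x * m⌉₊ ≤ m := Nat.ceil_le.2 (by nlinarith)
  refine ⟨⌈x * m⌉₊ - 1, by omega, (hmem _).2 (by omega), fun l' hl' => ?_⟩
  have := (hmem _).1 hl'
  omega

theorem volume_preimage_nsmul {N : ℕ} (hN : 0 < N) {E : Set UnitAddCircle} (hE : MeasurableSet E) :
    volume {θ : UnitAddCircle | N • θ ∈ E} = volume E := by
  rcases lt_or_eq_of_le (Nat.succ_le_of_lt hN) with h | rfl
  · exact (AddCircle.ergodic_nsmul h).toMeasurePreserving.measure_preimage hE.nullMeasurableSet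
  · simp

/-- Multiplication by m stretches the arc to a full period, so the preimage of E under θ ↦ mNθ is
independent of every arc of length 1/m. -/
theorem volume_arc_inter {m l N : ℕ} (hm : 0 < m) (hl : l < m) (hN : 0 < N)
    {E : Set UnitAddCircle} (hE : MeasurableSet E) :
    volume (arc m l ∩ {θ | (m * N) • θ ∈ E}) = volume E / m := by
  have hm' : (0 : ℝ) < m := by exact_mod_cast hm
  have hEN : MeasurableSet {θ : UnitAddCircle | N • θ ∈ E} := hE.preimage (by fun_prop)
  have hEN' : MeasurableSet {θ : UnitAddCircle | (m * N) • θ ∈ E} := hE.preimage (by fun_prop)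
  rw [← (UnitAddCircle.measurePreserving_mk 0).measure_preimage
    ((measurableSet_arc m l).inter hEN').nullMeasurableSet,
    Measure.restrict_apply' measurableSet_Ioc]
  have h1 := (UnitAddCircle.measurePreserving_mk l).measure_preimage hEN.nullMeasurableSet
  rw [Measure.restrict_apply' measurableSet_Ioc, volume_preimage_nsmul hN hE] at h1
  rw [← h1]
  have h2 := Real.volume_preimage_mul_left hm'.ne'
    (((↑) : ℝ → UnitAddCircle) ⁻¹' {θ | N • θ ∈ E} ∩ Set.Ioc (l : ℝ) (l + 1))
  rw [abs_of_pos (inv_pos.2 hm'), ENNReal.ofReal_inv_of_pos hm', ENNReal.ofReal_natCast, mul_comm,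
    ← div_eq_mul_inv] at h2
  rw [← h2]
  congr 1
  ext x
  have hcoe : (((m : ℝ) * x : ℝ) : UnitAddCircle) = m • (x : UnitAddCircle) := by
    rw [← nsmul_eq_mul]; rfl
  have hio : (m : ℝ) * x ∈ Set.Ioc (l : ℝ) (l + 1) ↔ x ∈ Set.Ioc ((l : ℝ) / m) ((l + 1) / m) := by
    simp only [Set.mem_Ioc, div_lt_iff₀ hm', le_div_iff₀ hm', mul_comm x]
  have hsub : x ∈ Set.Ioc ((l : ℝ) / m) ((l + 1) / m) → x ∈ Set.Ioc (0 : ℝ) 1 := fun h =>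
    ⟨lt_of_le_of_lt (by positivity) h.1, h.2.trans ((div_le_one hm').2 (by exact_mod_cast hl))⟩
  simp only [Set.mem_inter_iff, Set.mem_preimage, zero_add, hio, Set.mem_ofPred, hcoe, smul_smul,
    mul_comm N m]
  constructor
  · rintro ⟨⟨h1, h2⟩, h3⟩
    exact ⟨h2, (coe_mem_arc h3).1 h1⟩
  · rintro ⟨h1, h2⟩
    exact ⟨⟨(coe_mem_arc (hsub h2)).2 h2, h1⟩, hsub h2⟩

theorem volume_arc {m l : ℕ} (hm : 0 < m) (hl : l < m) : volume (arc m l) = (m : ENNReal)⁻¹ := by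
  have := volume_arc_inter hm hl one_pos MeasurableSet.univ
  simpa using this

/-! ### Fourier sums of indicator functions -/

theorem haarAddCircle_eq_volume :
    (AddCircle.haarAddCircle : Measure UnitAddCircle) = volume := by
  rw [AddCircle.volume_eq_smul_haarAddCircle]; simp

/-- Partial sums of the Fourier series of an indicator function approximate it in measure. -/
theorem exists_fourier_sum_close_indicator {J : Set UnitAddCircle} (hJ : MeasurableSet J)
    {q : ℝ} (hq : 2 < q) {δ : ℝ} (hδ : 0 < δ) :
    ∃ (s : Finset ℤ) (a : ℤ → ℂ),
      volume {θ | δ ≤ ‖∑ n ∈ s, a n * fourier n θ - J.indicator (fun _ => (1 : ℂ)) θ‖}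
        < ENNReal.ofReal δ ∧
      ∑ n ∈ s, ‖a n‖ ^ q ≤ volume.real J ^ (q - 1) := by
  set f : Lp ℂ 2 (AddCircle.haarAddCircle : Measure UnitAddCircle) :=
    indicatorConstLp 2 hJ (measure_ne_top _ _) 1 with hf
  have hfJ : f =ᵐ[AddCircle.haarAddCircle] J.indicator fun _ => (1 : ℂ) := indicatorConstLp_coeFn
  have hint : ∫ θ, J.indicator (fun _ => (1 : ℝ)) θ ∂AddCircle.haarAddCircle = volume.real J := by
    rw [integral_indicator hJ, haarAddCircle_eq_volume]
    simp
  have hnorm : ∀ θ, ‖J.indicator (fun _ => (1 : ℂ)) θ‖ = J.indicator (fun _ => (1 : ℝ)) θ := by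
    intro θ
    by_cases h : θ ∈ J <;> simp [h]
  -- The coefficients are bounded by the L¹ norm and their square sum by Parseval, both equal to
  -- |J|; interpolation gives |J|^{q-2} · |J|.
  have hsup : ∀ n, ‖fourierCoeff f n‖ ≤ volume.real J := by
    intro n
    rw [fourierCoeff, ← hint]
    refine (norm_integral_le_integral_norm _).trans_eq (integral_congr_ae ?_)
    filter_upwards [hfJ] with θ hθ
    rw [norm_smul, norm_fourier_apply, one_mul, hθ, hnorm]
  have hsq : ∀ s : Finset ℤ, ∑ n ∈ s, ‖fourierCoeff f n‖ ^ 2 ≤ volume.real J := by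
    intro s
    have h1 := hasSum_sq_fourierCoeff f
    refine (sum_le_hasSum s (fun _ _ => by positivity) h1).trans_eq ?_
    rw [← hint]
    refine integral_congr_ae ?_
    filter_upwards [hfJ] with θ hθ
    rw [hθ, hnorm]
    by_cases h : θ ∈ J <;> simp [h]
  have hlim := (tendstoInMeasure_of_tendsto_Lp (hasSum_fourier_series_L2 f)) (ENNReal.ofReal δ)
    (ENNReal.ofReal_pos.2 hδ)
  obtain ⟨s, hs⟩ := (hlim.eventually (gt_mem_nhds (ENNReal.ofReal_pos.2 hδ))).exists
  refine ⟨s, fourierCoeff f, ?_, ?_⟩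
  · rw [← haarAddCircle_eq_volume]
    refine lt_of_eq_of_lt (measure_congr ?_) hs
    have h2 : ∀ n : ℤ, (fourierCoeff f n • fourierLp 2 n : Lp ℂ 2 (AddCircle.haarAddCircle (T := 1)))
        =ᵐ[AddCircle.haarAddCircle] fun θ => fourierCoeff f n * fourier (T := 1) n θ := by
      intro n
      filter_upwards [Lp.coeFn_smul (fourierCoeff f n) (fourierLp (T := 1) 2 n),
        coeFn_fourierLp (T := 1) 2 n] with θ h3 h4
      rw [h3, Pi.smul_apply, h4, smul_eq_mul]
    have h5 : (∑ n ∈ s, fourierCoeff f n • fourierLp 2 n : Lp ℂ 2 (AddCircle.haarAddCircle (T := 1)))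
        =ᵐ[AddCircle.haarAddCircle] fun θ => ∑ n ∈ s, fourierCoeff f n * fourier (T := 1) n θ := by
      have h6 := Lp.coeFn_finsetSum s fun n =>
        (fourierCoeff f n • fourierLp 2 n : Lp ℂ 2 (AddCircle.haarAddCircle (T := 1)))
      filter_upwards [h6, (ae_ball_iff s.countable_toSet).2 fun n _ => h2 n] with θ h7 h8
      rw [h7, Finset.sum_apply]
      exact Finset.sum_congr rfl fun n hn => h8 n hn
    filter_upwards [h5, hfJ] with θ h9 h10
    refine propext ?_
    change δ ≤ ‖∑ n ∈ s, fourierCoeff f n * fourier n θ - J.indicator (fun _ => (1 : ℂ)) θ‖ ↔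
      ENNReal.ofReal δ ≤ edist ((∑ n ∈ s, fourierCoeff f n • fourierLp 2 n :
        Lp ℂ 2 AddCircle.haarAddCircle) θ) (f θ)
    rw [h9, h10, edist_dist, dist_eq_norm, ENNReal.ofReal_le_ofReal_iff (norm_nonneg _)]
  · calc ∑ n ∈ s, ‖fourierCoeff f n‖ ^ q
        ≤ ∑ n ∈ s, volume.real J ^ (q - 2) * ‖fourierCoeff f n‖ ^ 2 := by
          refine Finset.sum_le_sum fun n _ => ?_
          have h1 : ‖fourierCoeff f n‖ ^ q
              = ‖fourierCoeff f n‖ ^ (q - 2) * ‖fourierCoeff f n‖ ^ 2 := by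
            rw [← Real.rpow_natCast, ← Real.rpow_add' (norm_nonneg _) (by push_cast; linarith)]
            simp
          rw [h1]
          have := hsup n
          gcongr
      _ = volume.real J ^ (q - 2) * ∑ n ∈ s, ‖fourierCoeff f n‖ ^ 2 := by rw [Finset.mul_sum]
      _ ≤ volume.real J ^ (q - 2) * volume.real J := by
          have := hsq s
          gcongr
      _ = volume.real J ^ (q - 1) := by
          rw [show q - 1 = (q - 2) + 1 by ring,
            Real.rpow_add' measureReal_nonneg (by linarith), Real.rpow_one]

/-! ### Reducing the ℓ_q norm of the coefficients -/

/-- Injectivity of φ keeps the monomials from merging. -/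
theorem sum_support_norm_coeff_rpow_le {ι : Type*} (I : Finset ι) (φ : ι → ℕ)
    (hφ : Set.InjOn φ I) (b : ι → ℂ) (q : ℝ) :
    ∑ i ∈ (∑ i ∈ I, Polynomial.monomial (φ i) (b i)).support,
      ‖(∑ i ∈ I, Polynomial.monomial (φ i) (b i)).coeff i‖ ^ q ≤ ∑ i ∈ I, ‖b i‖ ^ q := by
  classical
  have hcoeff : ∀ i ∈ I, (∑ i ∈ I, Polynomial.monomial (φ i) (b i)).coeff (φ i) = b i := by
    intro i hi
    rw [Polynomial.finsetSum_coeff, Finset.sum_eq_single_of_mem i hi]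
    · simp
    · intro j hj hji
      rw [Polynomial.coeff_monomial, if_neg]
      exact fun h => hji (hφ hj hi h)
  have hsub : (∑ i ∈ I, Polynomial.monomial (φ i) (b i)).support ⊆ I.image φ := by
    intro n hn
    rw [Polynomial.mem_support_iff, Polynomial.finsetSum_coeff] at hn
    obtain ⟨i, hi, hne⟩ := Finset.exists_ne_zero_of_sum_ne_zero hn
    rw [Polynomial.coeff_monomial] at hne
    exact Finset.mem_image.2 ⟨i, hi, by by_contra h; exact hne (if_neg h)⟩
  refine (Finset.sum_le_sum_of_subset_of_nonneg hsub fun _ _ _ => by positivity).trans_eq ?_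
  rw [Finset.sum_image hφ]
  exact Finset.sum_congr rfl fun i hi => by rw [hcoeff i hi]

/-- Integers `n + j K ^ (l + 1)` with `|n|` and `j` small compared to `K` are positive and
determine `n`, `j` and `l`. -/
theorem add_mul_pow_pos {K d : ℕ} (hK : 2 * d < K) {n : ℤ} (hn : |n| ≤ d) {j l : ℕ} (hj : 0 < j) :
    0 < n + j * (K : ℤ) ^ (l + 1) := by
  have h1 : (K : ℤ) ≤ j * (K : ℤ) ^ (l + 1) := by
    have : K ≤ j * K ^ (l + 1) := by
      calc K = 1 * K ^ 1 := by simp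
        _ ≤ j * K ^ (l + 1) := by
          gcongr
          · omega
          · omega
          · omega
    exact_mod_cast this
  have := (abs_le.1 hn).1
  have : (2 * d : ℤ) < K := by exact_mod_cast hK
  linarith

/-- If l < l', cancelling K^(l+1) exhibits j as a positive multiple of K, against j < K. -/
theorem mul_pow_inj_aux {K j j' l l' : ℕ} (hj : 0 < j) (hj' : 0 < j') (hjK : j < K)
    (h : j * K ^ (l + 1) = j' * K ^ (l' + 1)) : l' ≤ l := by
  by_contra! hc
  obtain ⟨t, rfl⟩ := Nat.exists_eq_add_of_lt hc
  have hK : 0 < K := by omega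
  have h1 : j * K ^ (l + 1) = (j' * K ^ t * K) * K ^ (l + 1) := by rw [h]; ring
  have h2 := Nat.eq_of_mul_eq_mul_right (by positivity) h1
  have h3 : K ≤ j' * K ^ t * K := Nat.le_mul_of_pos_left _ (by positivity)
  omega

/-- Modulo K only n - n' is left, and |n - n'| ≤ 2d < K forces n = n'; the rest is `mul_pow_inj_aux`
in both directions. -/
theorem add_mul_pow_inj {K d : ℕ} (hK : 2 * d < K) {n n' : ℤ} (hn : |n| ≤ d) (hn' : |n'| ≤ d)
    {j j' l l' : ℕ} (hj : 0 < j) (hj' : 0 < j') (hjK : j < K) (hjK' : j' < K)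
    (h : n + j * (K : ℤ) ^ (l + 1) = n' + j' * (K : ℤ) ^ (l' + 1)) :
    l = l' ∧ j = j' ∧ n = n' := by
  have hd : (K : ℤ) ∣ n - n' := by
    refine ⟨j' * (K : ℤ) ^ l' - j * (K : ℤ) ^ l, ?_⟩
    rw [pow_succ, pow_succ] at h
    linear_combination h
  have hnn : n = n' := by
    rw [← sub_eq_zero]
    refine Int.eq_zero_of_abs_lt_dvd hd ?_
    have h1 := abs_sub n n'
    have : (2 * d : ℤ) < K := by exact_mod_cast hK
    linarith
  subst hnn
  have h2 : j * K ^ (l + 1) = j' * K ^ (l' + 1) := by exact_mod_cast add_left_cancel h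
  have hl : l = l' := le_antisymm (mul_pow_inj_aux hj' hj hjK' h2.symm)
    (mul_pow_inj_aux hj hj' hjK h2)
  subst hl
  have hK0 : 0 < K := by omega
  exact ⟨rfl, Nat.eq_of_mul_eq_mul_right (by positivity) h2, rfl⟩

/-- Polynomials without constant term and with small `ℓ_q` norm of the coefficients approximate `1`
in measure on the unit circle. -/
theorem exists_polynomial_close_one_small_coeff {q : ℝ} (hq : 2 < q) {δ : ℝ} (hδ : 0 < δ) :
    ∃ P : Polynomial ℂ, P.coeff 0 = 0 ∧ ∑ i ∈ P.support, ‖P.coeff i‖ ^ q < δ ∧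
      volume {θ : UnitAddCircle | δ < ‖P.eval (fourier 1 θ) - 1‖} < ENNReal.ofReal δ := by
  obtain ⟨P, hP0, hP⟩ := exists_polynomial_close_one (half_pos hδ)
  obtain ⟨A, hA1, hA⟩ := exists_norm_eval_le P
  set S : ℝ := ∑ i ∈ P.support, ‖P.coeff i‖ ^ q with hS
  -- Each of m arcs will contribute at most S m^{-(q-1)} to the coefficient sum; the total S
  -- m^{-(q-2)} tends to 0 because q > 2.
  obtain ⟨m, hm, hmS⟩ : ∃ m : ℕ, 0 < m ∧ S * (m : ℝ) ^ (-(q - 2)) < δ := by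
    have h1 : Tendsto (fun m : ℕ => S * (m : ℝ) ^ (-(q - 2))) atTop (𝓝 (S * 0)) :=
      ((tendsto_rpow_neg_atTop (by linarith)).comp tendsto_natCast_atTop_atTop).const_mul S
    rw [mul_zero] at h1
    exact ((eventually_gt_atTop 0).and (h1.eventually (gt_mem_nhds hδ))).exists
  have hm' : (0 : ℝ) < m := by exact_mod_cast hm
  -- Errors of this size on m arcs, each multiplied by at most A, add up to δ/2.
  have hη : 0 < δ / (2 * m * A) := by positivity
  choose s a hsa ha using fun l => exists_fourier_sum_close_indicator (measurableSet_arc m l) hq hη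
  obtain ⟨d, hd⟩ : ∃ d : ℕ, ∀ l < m, ∀ n ∈ s l, |n| ≤ d := by
    refine ⟨∑ l ∈ Finset.range m, ∑ n ∈ s l, n.natAbs, fun l hl n hn => ?_⟩
    rw [Int.abs_eq_natAbs]
    exact_mod_cast (Finset.single_le_sum (f := fun n => Int.natAbs n) (fun _ _ => Nat.zero_le _)
      hn).trans (Finset.single_le_sum (f := fun l => ∑ n ∈ s l, n.natAbs)
        (fun _ _ => Nat.zero_le _) (Finset.mem_range.2 hl))
  -- The factor m is needed for `volume_arc_inter`; the other puts K above 2d and deg P, so that the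
  -- frequencies n + jK^(l+1) are positive and distinct.
  set K : ℕ := m * (2 * d + P.natDegree + 1) with hK
  have hKle : 2 * d + P.natDegree + 1 ≤ K := Nat.le_mul_of_pos_left _ hm
  set I : Finset (Σ _ : ℕ, ℕ × ℤ) :=
    (Finset.range m).sigma fun l => P.support ×ˢ s l with hI
  set φ : (Σ _ : ℕ, ℕ × ℤ) → ℕ := fun i => (i.2.2 + i.2.1 * (K : ℤ) ^ (i.1 + 1)).toNat with hφ
  set b : (Σ _ : ℕ, ℕ × ℤ) → ℂ := fun i => P.coeff i.2.1 * a i.1 i.2.2 with hb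
  have hmem : ∀ i ∈ I, i.1 < m ∧ 0 < i.2.1 ∧ i.2.1 < K ∧ |i.2.2| ≤ d := by
    rintro ⟨l, j, n⟩ hi
    simp only [hI, Finset.mem_sigma, Finset.mem_range, Finset.mem_product] at hi
    refine ⟨hi.1, ?_, ?_, hd l hi.1 n hi.2.2⟩
    · rcases Nat.eq_zero_or_pos j with rfl | h
      · exact absurd hP0 (Polynomial.mem_support_iff.1 hi.2.1)
      · exact h
    · have := Polynomial.le_natDegree_of_mem_supp j hi.2.1
      change j < K
      omega
  have hφpos : ∀ i ∈ I, 0 < i.2.2 + i.2.1 * (K : ℤ) ^ (i.1 + 1) := fun i hi =>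
    add_mul_pow_pos (by omega) (hmem i hi).2.2.2 (hmem i hi).2.1
  have hinj : Set.InjOn φ I := by
    rintro ⟨l, j, n⟩ hi ⟨l', j', n'⟩ hi' h
    have h1 := hφpos _ hi
    have h2 := hφpos _ hi'
    have h3 : (n + j * (K : ℤ) ^ (l + 1)) = n' + j' * (K : ℤ) ^ (l' + 1) := by
      simp only [hφ] at h h1 h2
      omega
    obtain ⟨-, hj, hjK, hn⟩ := hmem _ hi
    obtain ⟨-, hj', hjK', hn'⟩ := hmem _ hi'
    obtain ⟨rfl, rfl, rfl⟩ := add_mul_pow_inj (by omega) hn hn' hj hj' hjK hjK' h3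
    rfl
  -- Q(z) is the sum over l of T_l(z) P(z^(K^(l+1))), with T_l a trigonometric sum close to the
  -- indicator of the l-th arc. On that arc essentially one term survives, and it is mostly close to
  -- 1.
  set Q : Polynomial ℂ := ∑ i ∈ I, Polynomial.monomial (φ i) (b i) with hQ
  have hQeval : ∀ θ : UnitAddCircle, Q.eval (fourier 1 θ) = ∑ l ∈ Finset.range m,
      (∑ n ∈ s l, a l n * fourier n θ) * P.eval (fourier 1 (K ^ (l + 1) • θ)) := by
    intro θ
    rw [hQ, Polynomial.eval_finsetSum, hI, Finset.sum_sigma]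
    refine Finset.sum_congr rfl fun l hl => ?_
    rw [Polynomial.eval_eq_sum, Polynomial.sum, mul_comm, Finset.sum_mul_sum,
      ← Finset.sum_product']
    refine Finset.sum_congr rfl fun ⟨j, n⟩ hjn => ?_
    have hpos := hφpos ⟨l, j, n⟩ (Finset.mem_sigma.2 ⟨hl, hjn⟩)
    have h1 : ((φ ⟨l, j, n⟩ : ℕ) : ℤ) = n + ((j * K ^ (l + 1) : ℕ) : ℤ) := by
      simp only [hφ]
      rw [Int.toNat_of_nonneg hpos.le]
      push_cast
      ring
    rw [Polynomial.eval_monomial, ← fourier_natCast_apply, h1, fourier_add, fourier_natCast_apply,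
      fourier_one_nsmul, ← pow_mul, mul_comm j]
    simp only [hb]
    ring
  have hvolarc : ∀ l < m, volume.real (arc m l) = (m : ℝ)⁻¹ := fun l hl => by
    simp [measureReal_def, volume_arc hm hl]
  refine ⟨Q, ?_, ?_, ?_⟩
  · rw [hQ, Polynomial.finsetSum_coeff]
    refine Finset.sum_eq_zero fun i hi => ?_
    rw [Polynomial.coeff_monomial, if_neg]
    have := hφpos i hi
    simp only [hφ]
    omega
  · refine lt_of_le_of_lt (sum_support_norm_coeff_rpow_le I φ hinj b q) (lt_of_le_of_lt ?_ hmS)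
    rw [hI, Finset.sum_sigma]
    calc ∑ l ∈ Finset.range m, ∑ i ∈ P.support ×ˢ s l, ‖b ⟨l, i⟩‖ ^ q
        = ∑ l ∈ Finset.range m, S * ∑ n ∈ s l, ‖a l n‖ ^ q := by
          refine Finset.sum_congr rfl fun l _ => ?_
          rw [hS, Finset.sum_mul_sum, ← Finset.sum_product']
          refine Finset.sum_congr rfl fun i _ => ?_
          rw [hb, norm_mul, Real.mul_rpow (norm_nonneg _) (norm_nonneg _)]
      _ ≤ ∑ l ∈ Finset.range m, S * ((m : ℝ)⁻¹) ^ (q - 1) := by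
          refine Finset.sum_le_sum fun l hl => ?_
          have := ha l
          rw [hvolarc l (Finset.mem_range.1 hl)] at this
          have hS0 : 0 ≤ S := Finset.sum_nonneg fun _ _ => by positivity
          gcongr
      _ = S * (m : ℝ) ^ (-(q - 2)) := by
          rw [Finset.sum_const, Finset.card_range, nsmul_eq_mul, Real.inv_rpow hm'.le,
            ← Real.rpow_neg hm'.le, mul_left_comm]
          congr 1
          rw [show -(q - 2) = 1 + -(q - 1) by ring, Real.rpow_add hm', Real.rpow_one]
  · set E : Set UnitAddCircle := {θ | δ / 2 < ‖P.eval (fourier 1 θ) - 1‖} with hE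
    have hEm : MeasurableSet E := by
      refine measurableSet_lt measurable_const (Continuous.measurable ?_)
      have := P.continuous
      fun_prop
    -- Two ways to fail: T_l is far from the indicator, or θ is in the l-th arc and the dilated P is
    -- far from 1. By independence the second set has measure |E|/m, so all m arcs together lose
    -- less than δ.
    set B : ℕ → Set UnitAddCircle := fun l =>
      {θ | δ / (2 * m * A) ≤ ‖∑ n ∈ s l, a l n * fourier n θ -
        (arc m l).indicator (fun _ => (1 : ℂ)) θ‖} ∪ (arc m l ∩ {θ | K ^ (l + 1) • θ ∈ E}) with hB
    have hsub : {θ : UnitAddCircle | δ < ‖Q.eval (fourier 1 θ) - 1‖}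
        ⊆ ⋃ l ∈ Finset.range m, B l := by
      intro θ hθ
      by_contra hc
      simp only [Set.mem_iUnion, not_exists, hB, Set.mem_union, Set.mem_ofPred, not_or,
        Set.mem_inter_iff, not_and, not_le, Finset.mem_range] at hc
      obtain ⟨l₀, hl₀, hθl₀, huniq⟩ := arc_existsUnique hm θ
      have h1 : ∑ l ∈ Finset.range m, (arc m l).indicator (fun _ => (1 : ℂ)) θ *
          P.eval (fourier 1 (K ^ (l + 1) • θ)) = P.eval (fourier 1 (K ^ (l₀ + 1) • θ)) := by
        rw [Finset.sum_eq_single_of_mem l₀ (Finset.mem_range.2 hl₀)]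
        · rw [Set.indicator_of_mem hθl₀, one_mul]
        · intro l _ hl
          rw [Set.indicator_of_notMem (fun h => hl (huniq l h)), zero_mul]
      have h2 : ‖P.eval (fourier 1 (K ^ (l₀ + 1) • θ)) - 1‖ ≤ δ / 2 :=
        not_lt.1 ((hc l₀ hl₀).2 hθl₀)
      have h3 : ‖Q.eval (fourier 1 θ) - P.eval (fourier 1 (K ^ (l₀ + 1) • θ))‖ ≤ δ / 2 := by
        rw [hQeval, ← h1, ← Finset.sum_sub_distrib]
        calc _ ≤ ∑ l ∈ Finset.range m, δ / (2 * m * A) * A := by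
              refine norm_sum_le_of_le _ fun l hl => ?_
              rw [← sub_mul, norm_mul]
              have h4 := (hc l (Finset.mem_range.1 hl)).1.le
              have h5 := hA _ (norm_fourier_apply 1 (K ^ (l + 1) • θ))
              gcongr
          _ = δ / 2 := by
              rw [Finset.sum_const, Finset.card_range, nsmul_eq_mul]
              field_simp
      have h6 := norm_sub_le_norm_sub_add_norm_sub (Q.eval (fourier 1 θ))
        (P.eval (fourier 1 (K ^ (l₀ + 1) • θ))) 1
      have := Set.mem_ofPred.1 hθ
      linarith
    have hBl : ∀ l ∈ Finset.range m, volume (B l) < ENNReal.ofReal (δ / m) := by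
      intro l hl
      have hKl : K ^ (l + 1) = m * ((2 * d + P.natDegree + 1) * K ^ l) := by
        rw [pow_succ, hK]; ring
      have h1 : volume (arc m l ∩ {θ | K ^ (l + 1) • θ ∈ E}) < ENNReal.ofReal (δ / (2 * m)) := by
        rw [hKl, volume_arc_inter hm (Finset.mem_range.1 hl) (by positivity) hEm,
          show δ / (2 * m) = δ / 2 / m by field_simp, ENNReal.ofReal_div_of_pos hm',
          ENNReal.ofReal_natCast]
        exact ENNReal.div_lt_div_right (by positivity) (ENNReal.natCast_ne_top m) hP
      have h2 := hsa l
      have h3 : ENNReal.ofReal (δ / (2 * m * A)) ≤ ENNReal.ofReal (δ / (2 * m)) := by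
        refine ENNReal.ofReal_le_ofReal ?_
        exact div_le_div_of_nonneg_left hδ.le (by positivity)
          (le_mul_of_one_le_right (by positivity) hA1)
      calc volume (B l) ≤ _ := measure_union_le _ _
        _ < ENNReal.ofReal (δ / (2 * m)) + ENNReal.ofReal (δ / (2 * m)) :=
            ENNReal.add_lt_add (h2.trans_le h3) h1
        _ = ENNReal.ofReal (δ / m) := by
            rw [← ENNReal.ofReal_add (by positivity) (by positivity)]
            congr 1
            field_simp
            norm_num
    calc _ ≤ volume (⋃ l ∈ Finset.range m, B l) := measure_mono hsub
      _ ≤ ∑ l ∈ Finset.range m, volume (B l) := measure_biUnion_finset_le _ _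
      _ < ∑ l ∈ Finset.range m, ENNReal.ofReal (δ / m) :=
          ENNReal.sum_lt_sum_of_nonempty ⟨0, Finset.mem_range.2 hm⟩ hBl
      _ = ENNReal.ofReal δ := by
          rw [Finset.sum_const, Finset.card_range, nsmul_eq_mul, ← ENNReal.ofReal_natCast,
            ← ENNReal.ofReal_mul hm'.le]
          congr 1
          field_simp

/-! ### Frequency sequences containing prescribed arithmetic blocks -/

theorem exists_block_index {N : ℕ → ℕ} (h0 : N 0 = 0) (hN : StrictMono N) (n : ℕ) :
    ∃ k, N k ≤ n ∧ n < N (k + 1) := by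
  have h : ∃ k, n < N k := ⟨n + 1, (Nat.lt_succ_self n).trans_le (hN.id_le _)⟩
  classical
  obtain ⟨k, hk⟩ : ∃ k, Nat.find h = k + 1 := by
    refine Nat.exists_eq_succ_of_ne_zero fun h1 => ?_
    have := Nat.find_spec h
    rw [h1, h0] at this
    omega
  refine ⟨k, not_lt.1 (Nat.find_min h (by omega)), ?_⟩
  have := Nat.find_spec h
  rwa [hk] at this

theorem block_index_unique {N : ℕ → ℕ} (hN : StrictMono N) {n k k' : ℕ} (h1 : N k ≤ n)
    (h2 : n < N (k + 1)) (h1' : N k' ≤ n) (h2' : n < N (k' + 1)) : k = k' := by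
  have := hN.lt_iff_lt.1 (h1.trans_lt h2')
  have := hN.lt_iff_lt.1 (h1'.trans_lt h2)
  omega

/-- An arithmetic progression `1, …, M` continued by a geometric one with ratio `H`. -/
def progression (M H j : ℕ) : ℕ := if j < M then j + 1 else M * H ^ (j + 1 - M)

theorem progression_succ_of_lt {M H j : ℕ} (h : j + 1 < M) :
    progression M H (j + 1) = progression M H j + 1 := by
  simp [progression, h, (Nat.lt_succ_self j).trans h]

theorem progression_succ_of_le {M H j : ℕ} (h : M ≤ j + 1) :
    progression M H (j + 1) = H * progression M H j := by
  rw [progression, if_neg (by omega), progression]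
  split_ifs with h1
  · obtain rfl : M = j + 1 := by omega
    simp [mul_comm]
  · rw [show j + 1 + 1 - M = (j + 1 - M) + 1 by omega, pow_succ]
    ring

theorem progression_pos {M H : ℕ} (hM : 0 < M) (hH : 0 < H) (j : ℕ) : 0 < progression M H j := by
  rw [progression]
  split_ifs <;> positivity

/-- A step inside a block of frequencies `s + L a` increases the frequency by at least `1` and by
a factor greater than `1 + ε`. -/
theorem progression_step {s L ε E : ℝ} {M H j : ℕ} (hM : 0 < M) (hL : 4 * |s| + 4 ≤ L)
    (hε : 0 < ε) (hE : ε ≤ E) (hH : 1 + 2 * E < H) (hsmall : j + 1 < M → ε < 1 / (4 * M)) :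
    s + L * progression M H j + 1 ≤ s + L * progression M H (j + 1) ∧
    (1 + ε) * (s + L * progression M H j) < s + L * progression M H (j + 1) := by
  have hH0 : 0 < H := by
    have : (0 : ℝ) < H := by linarith
    exact_mod_cast this
  have hs1 := le_abs_self s
  have hs2 := neg_abs_le s
  have hs0 := abs_nonneg s
  have ha : (1 : ℝ) ≤ progression M H j := by exact_mod_cast progression_pos hM hH0 j
  -- In the arithmetic stretch the increment L beats ε·LM < L/4. In the geometric stretch s + La ≤
  -- 2La, which is why H exceeds 1 + 2E and not just 1 + E.
  by_cases h : j + 1 < M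
  · rw [progression_succ_of_lt h]
    have h1 : progression M H j = j + 1 := if_pos (by omega)
    have h2 : ((progression M H j : ℕ) : ℝ) + 1 ≤ M := by rw [h1]; exact_mod_cast h
    have h3 := hsmall h
    rw [lt_div_iff₀ (by positivity)] at h3
    push_cast
    refine ⟨by linarith, ?_⟩
    have h4 : s + L * progression M H j ≤ L * M := by nlinarith
    have h5 : ε * (s + L * progression M H j) ≤ ε * (L * M) := by gcongr
    nlinarith
  · rw [progression_succ_of_le (by omega)]
    push_cast
    set a : ℝ := ((progression M H j : ℕ) : ℝ)
    have hLa : L ≤ L * a := by nlinarith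
    have h2 : L * a * (1 + 2 * E) < L * a * H := by
      apply mul_lt_mul_of_pos_left hH
      linarith
    have hH2 : (2 : ℝ) ≤ H := by
      have : 1 < H := by
        have : (1 : ℝ) < H := by linarith
        exact_mod_cast this
      exact_mod_cast this
    constructor
    · have : L * a * 2 ≤ L * a * H := by
        apply mul_le_mul_of_nonneg_left hH2
        linarith
      nlinarith
    · have h3 : ε * (s + L * a) ≤ E * (2 * (L * a)) := by
        apply mul_le_mul hE <;> linarith
      nlinarith

theorem exists_block_sequence_aux (ε : ℕ → ℝ) (hε_pos : ∀ n, 0 < ε n)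
    (hε_lim : Tendsto ε atTop (𝓝 0)) (s : ℕ → ℝ) (M : ℕ → ℕ) (hM : ∀ k, 0 < M k) (hM0 : M 0 = 1) :
    ∃ (lam : ℕ → ℝ) (N L : ℕ → ℕ), (∀ n, 0 < lam n) ∧ (∀ n, lam n + 1 ≤ lam (n + 1)) ∧
      (∀ n, (1 + ε n) * lam n < lam (n + 1)) ∧ (∀ k, N k + M k ≤ N (k + 1)) ∧
      (∀ k, 0 < L k) ∧ ∀ k, ∀ j < M k, lam (N k + j) = s k + L k * (j + 1) := by
  obtain ⟨E, hE⟩ := hε_lim.bddAbove_range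
  replace hE : ∀ n, ε n ≤ E := fun n => hE ⟨n, rfl⟩
  have hE0 : 0 < E := (hε_pos 0).trans_le (hE 0)
  obtain ⟨H, hH⟩ := exists_nat_gt (1 + 2 * E)
  have hthr : ∀ k, ∃ t, ∀ n ≥ t, ε n < 1 / (4 * M k) := fun k => by
    have : (0 : ℝ) < M k := by exact_mod_cast hM k
    exact eventually_atTop.1 (hε_lim.eventually (gt_mem_nhds (by positivity)))
  choose thr hthr using hthr
  -- Block k + 1 waits until ε is below 1/(4 M (k+1)); the indices in between are filled by the
  -- geometric continuation of block k.
  set N : ℕ → ℕ := fun k => Nat.rec 0 (fun k x => max (x + M k) (thr (k + 1))) k with hN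
  have hN0 : N 0 = 0 := rfl
  have hNs : ∀ k, N (k + 1) = max (N k + M k) (thr (k + 1)) := fun k => rfl
  have hNM : ∀ k, N k + M k ≤ N (k + 1) := fun k => by rw [hNs]; exact le_max_left _ _
  have hNmono : StrictMono N := strictMono_nat_of_lt_succ fun k => by
    have := hNM k
    have := hM k
    omega
  -- Block 0 starts at index 0, where ε need not be small; `M 0 = 1` leaves it no arithmetic step.
  have hsmall : ∀ k n, N k ≤ n → 1 < M k → ε n < 1 / (4 * M k) := by
    rintro (_ | k) n hn h1
    · omega
    · exact hthr _ _ (le_trans (by rw [hNs]; exact le_max_right _ _) hn)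
  set p : ℕ → ℕ → ℕ := fun k => progression (M k) H with hp
  -- The first summand lifts the first frequency of block k + 1 above 1 + E times the last one of
  -- block k, plus 1; the second absorbs the shift s (k+1).
  set L : ℕ → ℕ := fun k => Nat.rec (4 * ⌈|s 0|⌉₊ + 4) (fun k x =>
    ⌈(1 + E) * (s k + x * p k (N (k + 1) - 1 - N k)) + 1⌉₊ + (4 * ⌈|s (k + 1)|⌉₊ + 4)) k with hL
  have hL0 : L 0 = 4 * ⌈|s 0|⌉₊ + 4 := rfl
  have hLs : ∀ k, L (k + 1) = ⌈(1 + E) * (s k + L k * p k (N (k + 1) - 1 - N k)) + 1⌉₊ +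
    (4 * ⌈|s (k + 1)|⌉₊ + 4) := fun k => rfl
  have hLge : ∀ k, 4 * |s k| + 4 ≤ (L k : ℝ) := by
    intro k
    have h1 := Nat.le_ceil (|s k|)
    rcases k with _ | k
    · rw [hL0]; push_cast; linarith
    · rw [hLs]; push_cast
      have : (0 : ℝ) ≤ ⌈(1 + E) * (s k + L k * p k (N (k + 1) - 1 - N k)) + 1⌉₊ := by positivity
      linarith
  have hcross : ∀ k, (1 + E) * (s k + L k * p k (N (k + 1) - 1 - N k)) + 1
      < s (k + 1) + L (k + 1) := by
    intro k
    have h1 := Nat.le_ceil (|s (k + 1)|)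
    have h2 := Nat.le_ceil ((1 + E) * (s k + L k * p k (N (k + 1) - 1 - N k)) + 1)
    have h3 := neg_abs_le (s (k + 1))
    have h4 := abs_nonneg (s (k + 1))
    rw [hLs]; push_cast
    linarith
  choose κ hκ1 hκ2 using exists_block_index hN0 hNmono
  have hκ : ∀ k n, N k ≤ n → n < N (k + 1) → κ n = k := fun k n h1 h2 =>
    block_index_unique hNmono (hκ1 n) (hκ2 n) h1 h2
  have hH0 : 0 < H := by
    have : (0 : ℝ) < H := by linarith
    exact_mod_cast this
  have hpos : ∀ k j, 0 < s k + L k * (p k j : ℝ) := by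
    intro k j
    have h1 : (1 : ℝ) ≤ p k j := by exact_mod_cast progression_pos (hM k) hH0 j
    have h2 := neg_abs_le (s k)
    have h3 := abs_nonneg (s k)
    have h4 := hLge k
    nlinarith
  have hstep : ∀ n, (s (κ n) + L (κ n) * (p (κ n) (n - N (κ n)) : ℝ) + 1
      ≤ s (κ (n + 1)) + L (κ (n + 1)) * (p (κ (n + 1)) (n + 1 - N (κ (n + 1))) : ℝ)) ∧
      (1 + ε n) * (s (κ n) + L (κ n) * (p (κ n) (n - N (κ n)) : ℝ))
      < s (κ (n + 1)) + L (κ (n + 1)) * (p (κ (n + 1)) (n + 1 - N (κ (n + 1))) : ℝ) := by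
    intro n
    have h1 := hκ1 n
    have h2 := hκ2 n
    by_cases h : n + 1 < N (κ n + 1)
    · rw [hκ (κ n) (n + 1) (by omega) h, show n + 1 - N (κ n) = n - N (κ n) + 1 by omega]
      exact progression_step (hM _) (hLge _) (hε_pos n) (hE n) hH
        fun h3 => hsmall _ _ h1 (by omega)
    · have h3 : n + 1 = N (κ n + 1) := by omega
      have h4 : κ (n + 1) = κ n + 1 := hκ _ _ h3.ge (by rw [h3]; exact hNmono (Nat.lt_succ_self (κ n + 1)))
      have h5 : n + 1 - N (κ n + 1) = 0 := by omega
      have h6 : p (κ n + 1) 0 = 1 := by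
        rw [hp]; exact (if_pos (hM _))
      have h7 : n - N (κ n) = N (κ n + 1) - 1 - N (κ n) := by omega
      rw [h4, h5, h6, h7, Nat.cast_one, mul_one]
      have h8 := hcross (κ n)
      have h9 := hpos (κ n) (N (κ n + 1) - 1 - N (κ n))
      have h10 := hE n
      have h11 := hε_pos n
      constructor <;> nlinarith
  refine ⟨fun n => s (κ n) + L (κ n) * p (κ n) (n - N (κ n)), N, L, fun n => hpos _ _,
    fun n => (hstep n).1, fun n => (hstep n).2, hNM, fun k => ?_, fun k j hj => ?_⟩
  · have h1 := hLge k
    have h2 := abs_nonneg (s k)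
    have : (0 : ℝ) < L k := by linarith
    exact_mod_cast this
  · have h1 : κ (N k + j) = k := hκ _ _ (by omega) (by have := hNM k; omega)
    have h2 : p k j = j + 1 := if_pos hj
    simp only [h1, Nat.add_sub_cancel_left, h2]
    push_cast
    rfl

/-- For every sequence `ε n → 0` there is a sequence of frequencies `lam` with
`lam (n + 1) > (1 + ε n) lam n` that contains, for every `k`, a block `s k + L k (j + 1)`,
`j < M k`. -/
theorem exists_block_sequence (ε : ℕ → ℝ) (hε_pos : ∀ n, 0 < ε n)
    (hε_lim : Tendsto ε atTop (𝓝 0)) (s : ℕ → ℝ) (M : ℕ → ℕ) (hM : ∀ k, 0 < M k) :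
    ∃ (lam : ℕ → ℝ) (N L : ℕ → ℕ), (∀ n, 0 < lam n) ∧ (∀ n, lam n + 1 ≤ lam (n + 1)) ∧
      (∀ n, (1 + ε n) * lam n < lam (n + 1)) ∧ (∀ k, N k + M k ≤ N (k + 1)) ∧
      (∀ k, 0 < L k) ∧ ∀ k, ∀ j < M k, lam (N k + j) = s k + L k * (j + 1) := by
  -- A dummy block of length 1 is put in front to meet `M 0 = 1`; the given blocks are shifted by
  -- one.
  obtain ⟨lam, N, L, h1, h2, h3, h4, h5, h6⟩ := exists_block_sequence_aux ε hε_pos hε_lim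
    (fun k => Nat.casesOn k 0 s) (fun k => Nat.casesOn k 1 M)
    (fun k => by cases k with | zero => exact one_pos | succ k => exact hM k) rfl
  exact ⟨lam, fun k => N (k + 1), fun k => L (k + 1), h1, h2, h3, fun k => h4 (k + 1),
    fun k => h5 (k + 1), fun k => h6 (k + 1)⟩

/-! ### Bessel inequality from Gram matrix bounds -/

section BesselAbstract

variable {ι H : Type*} [NormedAddCommGroup H] [InnerProductSpace ℂ H]

/-- Schur's test for the Gram matrix of a system of vectors. -/
theorem norm_sum_smul_sq_le_of_gram {u : ι → H} {B : ℝ}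
    (hB : ∀ (F : Finset ι) (m : ι), ∑ n ∈ F, ‖inner ℂ (u m) (u n)‖ ≤ B) (F : Finset ι) (c : ι → ℂ) :
    ‖∑ n ∈ F, c n • u n‖ ^ 2 ≤ B * ∑ n ∈ F, ‖c n‖ ^ 2 := by
  have h1 : ‖∑ n ∈ F, c n • u n‖ ^ 2
      ≤ ∑ m ∈ F, ∑ n ∈ F, ‖c m‖ * ‖c n‖ * ‖inner ℂ (u m) (u n)‖ := by
    have h2 : ‖inner ℂ (∑ m ∈ F, c m • u m) (∑ n ∈ F, c n • u n)‖
        ≤ ∑ m ∈ F, ∑ n ∈ F, ‖c m‖ * ‖c n‖ * ‖inner ℂ (u m) (u n)‖ := by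
      rw [sum_inner]
      refine norm_sum_le_of_le _ fun m _ => ?_
      rw [inner_sum]
      refine norm_sum_le_of_le _ fun n _ => ?_
      rw [inner_smul_left, inner_smul_right, norm_mul, norm_mul, RCLike.norm_conj, mul_assoc]
    rwa [inner_self_eq_norm_sq_to_K, norm_pow, RCLike.norm_ofReal, abs_norm] at h2
  have h3 : ∀ m n, ‖c m‖ * ‖c n‖ * ‖inner ℂ (u m) (u n)‖ ≤
      (1 / 2) * (‖c m‖ ^ 2 * ‖inner ℂ (u m) (u n)‖) +
        (1 / 2) * (‖c n‖ ^ 2 * ‖inner ℂ (u n) (u m)‖) := by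
    intro m n
    rw [norm_inner_symm (u n)]
    nlinarith [mul_nonneg (sq_nonneg (‖c m‖ - ‖c n‖)) (norm_nonneg (inner ℂ (u m) (u n)))]
  have h4 : ∀ m, ∑ n ∈ F, ‖c m‖ ^ 2 * ‖inner ℂ (u m) (u n)‖ ≤ B * ‖c m‖ ^ 2 := by
    intro m
    rw [← Finset.mul_sum, mul_comm B]
    exact mul_le_mul_of_nonneg_left (hB F m) (by positivity)
  calc _ ≤ _ := h1
    _ ≤ ∑ m ∈ F, ∑ n ∈ F, ((1 / 2) * (‖c m‖ ^ 2 * ‖inner ℂ (u m) (u n)‖) +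
        (1 / 2) * (‖c n‖ ^ 2 * ‖inner ℂ (u n) (u m)‖)) :=
        Finset.sum_le_sum fun m _ => Finset.sum_le_sum fun n _ => h3 m n
    _ = ∑ m ∈ F, ∑ n ∈ F, ‖c m‖ ^ 2 * ‖inner ℂ (u m) (u n)‖ := by
        simp only [Finset.sum_add_distrib]
        rw [Finset.sum_comm (f := fun m n => (1 / 2) * (‖c n‖ ^ 2 * ‖inner ℂ (u n) (u m)‖)),
          ← Finset.sum_add_distrib]
        refine Finset.sum_congr rfl fun m _ => ?_
        rw [← Finset.sum_add_distrib]
        refine Finset.sum_congr rfl fun n _ => ?_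
        ring
    _ ≤ ∑ m ∈ F, B * ‖c m‖ ^ 2 := Finset.sum_le_sum fun m _ => h4 m
    _ = B * ∑ n ∈ F, ‖c n‖ ^ 2 := by rw [Finset.mul_sum]

/-- Duality: for a partial sum S and g = ∑ conj⟪f, u n⟫ • u n one has S = ⟪f, g⟫ ≤ ‖f‖ √(BS), hence
S ≤ B‖f‖². -/
theorem bessel_of_norm_sum_smul_sq_le {u : ι → H} {B : ℝ} (hB0 : 0 ≤ B)
    (hB : ∀ (F : Finset ι) (c : ι → ℂ), ‖∑ n ∈ F, c n • u n‖ ^ 2 ≤ B * ∑ n ∈ F, ‖c n‖ ^ 2) (f : H) :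
    Summable (fun n => ‖inner ℂ f (u n)‖ ^ 2) ∧
      Real.sqrt (∑' n, ‖inner ℂ f (u n)‖ ^ 2) ≤ √B * ‖f‖ := by
  have hfin : ∀ F : Finset ι, ∑ n ∈ F, ‖inner ℂ f (u n)‖ ^ 2 ≤ B * ‖f‖ ^ 2 := by
    intro F
    set S := ∑ n ∈ F, ‖inner ℂ f (u n)‖ ^ 2 with hS
    have hS0 : 0 ≤ S := Finset.sum_nonneg fun _ _ => by positivity
    set g : H := ∑ n ∈ F, (starRingEnd ℂ) (inner ℂ f (u n)) • u n with hg
    have h1 : ‖g‖ ^ 2 ≤ B * S := by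
      refine (hB F _).trans_eq ?_
      simp only [RCLike.norm_conj, hS]
    have h2 : (inner ℂ f g : ℂ) = (S : ℂ) := by
      rw [hg, inner_sum, hS]
      push_cast
      refine Finset.sum_congr rfl fun n _ => ?_
      rw [inner_smul_right, mul_comm, Complex.mul_conj, Complex.normSq_eq_norm_sq]
      push_cast
      rfl
    have h3 : S ≤ ‖f‖ * ‖g‖ := by
      have := norm_inner_le_norm (𝕜 := ℂ) f g
      rwa [h2, Complex.norm_real, Real.norm_of_nonneg hS0] at this
    by_contra! hc
    have h4 : S ^ 2 ≤ ‖f‖ ^ 2 * (B * S) := by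
      calc S ^ 2 ≤ (‖f‖ * ‖g‖) ^ 2 := by gcongr
        _ = ‖f‖ ^ 2 * ‖g‖ ^ 2 := by ring
        _ ≤ _ := by gcongr
    have h5 : 0 < S := lt_of_le_of_lt (by positivity) hc
    nlinarith
  have hsum : Summable (fun n => ‖inner ℂ f (u n)‖ ^ 2) :=
    summable_of_sum_le (fun _ => by positivity) hfin
  refine ⟨hsum, ?_⟩
  rw [Real.sqrt_le_left (by positivity), mul_pow, Real.sq_sqrt hB0]
  exact hsum.tsum_le_of_sum_le hfin

end BesselAbstract

/-! ### Exponentials under weights dominated by a Gaussian -/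

section Gaussian

theorem isWeight_gaussian : IsWeight fun x : ℝ => Real.exp (-x ^ 2) where
  integrable := by simpa using integrable_exp_neg_mul_sq one_pos
  pos := Eventually.of_forall fun x => Real.exp_pos _

variable {w : ℝ → ℝ}

theorem coeFn_expL2 (hw : IsWeight w) (l : ℝ) :
    expL2 hw l =ᵐ[weightMeasure w] fun x : ℝ => Complex.exp (Complex.I * l * x) :=
  MemLp.coeFn_toLp _

theorem coeFn_sum_expL2 {ι : Type*} (hw : IsWeight w) (F : Finset ι) (c : ι → ℂ) (l : ι → ℝ) :
    (∑ n ∈ F, c n • expL2 hw (l n) : WeightedL2 w)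
      =ᵐ[weightMeasure w] fun x : ℝ => ∑ n ∈ F, c n * Complex.exp (Complex.I * l n * x) := by
  have h1 : ∀ n ∈ F, (c n • expL2 hw (l n) : WeightedL2 w)
      =ᵐ[weightMeasure w] fun x : ℝ => c n * Complex.exp (Complex.I * l n * x) := by
    intro n _
    filter_upwards [Lp.coeFn_smul (c n) (expL2 hw (l n)), coeFn_expL2 hw (l n)] with x h2 h3
    rw [h2, Pi.smul_apply, h3, smul_eq_mul]
  filter_upwards [Lp.coeFn_finsetSum F fun n => (c n • expL2 hw (l n) : WeightedL2 w),
    (ae_ball_iff F.countable_toSet).2 h1] with x h4 h5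
  rw [h4, Finset.sum_apply]
  exact Finset.sum_congr rfl fun n hn => h5 n hn

/-- Upper bounds for finite sums, once known for the Gaussian, are thereby inherited by every
smaller weight. -/
theorem norm_sum_expL2_mono {ι : Type*} {w' : ℝ → ℝ} (hw : IsWeight w) (hw' : IsWeight w')
    (hle : ∀ x, w x ≤ w' x) (F : Finset ι) (c : ι → ℂ) (l : ι → ℝ) :
    ‖∑ n ∈ F, c n • expL2 hw (l n)‖ ≤ ‖∑ n ∈ F, c n • expL2 hw' (l n)‖ := by
  rw [Lp.norm_def, Lp.norm_def]
  refine ENNReal.toReal_mono (Lp.eLpNorm_ne_top _) ?_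
  rw [eLpNorm_congr_ae (coeFn_sum_expL2 hw F c l), eLpNorm_congr_ae (coeFn_sum_expL2 hw' F c l)]
  refine eLpNorm_mono_measure _ (withDensity_mono (Eventually.of_forall fun x => ?_))
  exact ENNReal.ofReal_le_ofReal (hle x)

/-- The inner product is the Fourier integral of the Gaussian at frequency b - a. -/
theorem norm_inner_expL2_gaussian (a b : ℝ) :
    ‖inner ℂ (expL2 isWeight_gaussian a) (expL2 isWeight_gaussian b)‖
      = √Real.pi * Real.exp (-(a - b) ^ 2 / 4) := by
  have h1 : inner ℂ (expL2 isWeight_gaussian a) (expL2 isWeight_gaussian b)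
      = ∫ x : ℝ, Complex.exp (Complex.I * ((b - a : ℝ) : ℂ) * x) * Complex.exp (-1 * (x : ℂ) ^ 2) := by
    rw [L2.inner_def, integral_congr_ae (g := fun x : ℝ => Complex.exp (Complex.I * ((b - a : ℝ) : ℂ) * x))]
    · rw [weightMeasure, integral_withDensity_eq_integral_toReal_smul (by fun_prop)
        (Eventually.of_forall fun x => ENNReal.ofReal_lt_top)]
      refine integral_congr_ae (Eventually.of_forall fun x => ?_)
      simp only [ENNReal.toReal_ofReal (Real.exp_pos _).le, Complex.real_smul]
      push_cast
      rw [mul_comm]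
      simp
    · filter_upwards [coeFn_expL2 isWeight_gaussian a, coeFn_expL2 isWeight_gaussian b] with x h2 h3
      rw [h2, h3, RCLike.inner_apply, ← Complex.exp_conj, ← Complex.exp_add]
      simp only [map_mul, Complex.conj_I, Complex.conj_ofReal]
      push_cast
      congr 1
      ring
  rw [h1, fourierIntegral_gaussian (by simp), norm_mul, Complex.norm_exp]
  congr 1
  · rw [div_one, show (1 / 2 : ℂ) = ((1 / 2 : ℝ) : ℂ) by push_cast; rfl,
      ← Complex.ofReal_cpow Real.pi_pos.le, Complex.norm_real, Real.sqrt_eq_rpow,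
      Real.norm_of_nonneg (by positivity)]
  · congr 1
    rw [show (-((b - a : ℝ) : ℂ) ^ 2 / (4 * 1)) = ((-(a - b) ^ 2 / 4 : ℝ) : ℂ) by push_cast; ring,
      Complex.ofReal_re]

theorem natCast_sub_le_of_add_one_le {lam : ℕ → ℝ} (hlam : ∀ n, lam n + 1 ≤ lam (n + 1)) (m k : ℕ) :
    lam m + k ≤ lam (m + k) := by
  induction k with
  | zero => simp
  | succ k ih => have := hlam (m + k); push_cast; rw [← add_assoc m]; linarith

theorem abs_sub_le_abs_sub {lam : ℕ → ℝ} (hlam : ∀ n, lam n + 1 ≤ lam (n + 1)) (m n : ℕ) :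
    |((m : ℤ) - n : ℤ)| ≤ |lam m - lam n| := by
  wlog h : n ≤ m generalizing m n
  · have h1 := this n m (by omega)
    rw [abs_sub_comm (lam m), abs_sub_comm (m : ℤ)]
    exact h1
  obtain ⟨k, rfl⟩ := Nat.exists_eq_add_of_le h
  have h1 := natCast_sub_le_of_add_one_le hlam n k
  push_cast
  rw [add_sub_cancel_left, Nat.abs_cast]
  exact le_trans (by linarith) (le_abs_self _)

/-- The Bessel inequality for exponentials with separated frequencies. -/
theorem exists_bessel_bound (hw : IsWeight w) (hle : ∀ x, w x ≤ Real.exp (-x ^ 2)) {lam : ℕ → ℝ}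
    (hlam : ∀ n, lam n + 1 ≤ lam (n + 1)) :
    ∃ C' : ℝ, ∀ f : WeightedL2 w, Summable (fun n => ‖inner ℂ f (expL2 hw (lam n))‖ ^ 2) ∧
      Real.sqrt (∑' n, ‖inner ℂ f (expL2 hw (lam n))‖ ^ 2) ≤ C' * ‖f‖ := by
  set r : ℝ := Real.exp (-1 / 4) with hr
  have hr0 : 0 < r := Real.exp_pos _
  have hr1 : r < 1 := by rw [hr, Real.exp_lt_one_iff]; norm_num
  have hsum : Summable fun k : ℤ => √Real.pi * r ^ k.natAbs := by
    refine Summable.mul_left _ (Summable.of_nat_of_neg ?_ ?_) <;>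
      simpa using summable_geometric_of_lt_one hr0.le hr1
  have hgram : ∀ (F : Finset ℕ) (m : ℕ),
      ∑ n ∈ F, ‖inner ℂ (expL2 isWeight_gaussian (lam m)) (expL2 isWeight_gaussian (lam n))‖
        ≤ ∑' k : ℤ, √Real.pi * r ^ k.natAbs := by
    intro F m
    have hinj : Set.InjOn (fun n : ℕ => (m : ℤ) - n) F := fun a _ b _ h => by
      simp only at h
      omega
    refine le_trans ?_ (hsum.sum_le_tsum (F.image fun n : ℕ => (m : ℤ) - n)
      fun _ _ => by positivity)
    rw [Finset.sum_image hinj]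
    refine Finset.sum_le_sum fun n _ => ?_
    rw [norm_inner_expL2_gaussian, hr, ← Real.exp_nat_mul]
    gcongr
    have h1 := abs_sub_le_abs_sub hlam m n
    have h2 : ((((m : ℤ) - n).natAbs : ℕ) : ℝ) = ((|(m : ℤ) - n| : ℤ) : ℝ) := by
      rw [Int.abs_eq_natAbs]; simp
    rw [h2, ← sq_abs (lam m - lam n)]
    -- For an integer t ≥ 0, t ≤ t²; this bounds the Gaussian decay by the geometric one, rᵗ with r
    -- = e^{-1/4}.
    have h3 : (((|(m : ℤ) - n| : ℤ) : ℝ)) ≤ ((|(m : ℤ) - n| : ℤ) : ℝ) ^ 2 := by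
      exact_mod_cast Int.le_self_sq _
    have h4 : (((|(m : ℤ) - n| : ℤ) : ℝ)) ^ 2 ≤ |lam m - lam n| ^ 2 := by
      gcongr
    linarith
  have hB0 : 0 ≤ ∑' k : ℤ, √Real.pi * r ^ k.natAbs := tsum_nonneg fun _ => by positivity
  refine ⟨√(∑' k : ℤ, √Real.pi * r ^ k.natAbs), bessel_of_norm_sum_smul_sq_le hB0 fun F c => ?_⟩
  refine le_trans ?_ (norm_sum_smul_sq_le_of_gram hgram F c)
  have := norm_sum_expL2_mono hw isWeight_gaussian hle F c lam
  gcongr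

end Gaussian

/-! ### Completeness of exponentials with dense frequencies -/

section FourierUniqueness
open FourierTransform SchwartzMap

/-- An integrable function with vanishing Fourier transform vanishes almost everywhere. -/
theorem ae_eq_zero_of_fourier_eq_zero {g : ℝ → ℂ} (hg : Integrable g) (h : ∀ t, 𝓕 g t = 0) :
    g =ᵐ[volume] 0 := by
  refine ae_eq_zero_of_integral_contDiff_smul_eq_zero hg.locallyIntegrable fun ψ hψ hψc => ?_
  have h1 : HasCompactSupport (Complex.ofRealCLM ∘ ψ) := hψc.comp_left rfl
  have h2 : ContDiff ℝ ((⊤ : ℕ∞) : WithTop ℕ∞) (Complex.ofRealCLM ∘ ψ) := by fun_prop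
  set Ψ : 𝓢(ℝ, ℂ) := h1.toSchwartzMap h2 with hΨ
  have h3 : ∀ x, 𝓕 ((𝓕⁻ Ψ : 𝓢(ℝ, ℂ)) : ℝ → ℂ) x = (ψ x : ℂ) := by
    intro x
    rw [← fourier_coe, FourierTransform.fourier_fourierInv_eq]
    rfl
  -- The test function is ψ = 𝓕(𝓕⁻ψ), and the multiplication formula moves the outer transform onto
  -- g.
  have h4 := VectorFourier.integral_fourierIntegral_smul_eq_flip (L := innerₗ ℝ)
    (f := ((𝓕⁻ Ψ : 𝓢(ℝ, ℂ)) : ℝ → ℂ)) (g := g) Real.continuous_fourierChar continuous_inner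
    ((𝓕⁻ Ψ : 𝓢(ℝ, ℂ)).integrable (μ := volume)) hg
  have h5 : ∀ x, VectorFourier.fourierIntegral Real.fourierChar volume (innerₗ ℝ)
      ((𝓕⁻ Ψ : 𝓢(ℝ, ℂ)) : ℝ → ℂ) x = (ψ x : ℂ) := h3
  have h6 : ∀ x, VectorFourier.fourierIntegral Real.fourierChar volume (innerₗ ℝ).flip g x = 0 := by
    intro x
    rw [flip_innerₗ]
    exact h x
  simp only [h5, h6, smul_zero, integral_zero] at h4
  rw [← h4]
  refine integral_congr_ae (Eventually.of_forall fun x => ?_)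
  simp

end FourierUniqueness

section Density
open FourierTransform

variable {w : ℝ → ℝ}

/-- Orthogonality to exponentials becomes vanishing of the transform of w f; the factor 2π matches
the kernel e^{-2πixt} of `𝓕`. -/
theorem inner_expL2_eq_fourier (hw : IsWeight w) (f : WeightedL2 w) (t : ℝ) :
    inner ℂ (expL2 hw (2 * Real.pi * t)) f
      = 𝓕 (fun x : ℝ => (ENNReal.ofReal (w x)).toReal • f x) t := by
  rw [L2.inner_def, integral_congr_ae (g := fun x : ℝ =>
      Complex.exp (((-2 * Real.pi * x * t : ℝ) : ℂ) * Complex.I) * f x)]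
  · refine (integral_withDensity_eq_integral_toReal_smul₀
      hw.integrable.1.aemeasurable.ennreal_ofReal
      (Eventually.of_forall fun x => ENNReal.ofReal_lt_top) _).trans ?_
    rw [Real.fourier_real_eq_integral_exp_smul]
    refine integral_congr_ae (Eventually.of_forall fun x => ?_)
    simp only [Complex.real_smul, smul_eq_mul]
    ring
  · filter_upwards [coeFn_expL2 hw (2 * Real.pi * t)] with x h2
    rw [h2, RCLike.inner_apply, ← Complex.exp_conj, mul_comm]
    simp only [map_mul, Complex.conj_I, Complex.conj_ofReal]
    push_cast
    congr 2
    ring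

/-- Exponentials with a dense set of frequencies span a dense subspace of `L²_w(ℝ)`. -/
theorem span_expL2_topologicalClosure_eq_top (hw : IsWeight w) {σ : ℕ → ℝ} (hσ : DenseRange σ) :
    (Submodule.span ℂ (Set.range fun i => expL2 hw (2 * Real.pi * σ i))).topologicalClosure = ⊤ := by
  have := hw.isFiniteMeasure
  rw [Submodule.topologicalClosure_eq_top_iff, Submodule.eq_bot_iff]
  intro f hf
  have h1 : ∀ i, inner ℂ (expL2 hw (2 * Real.pi * σ i)) f = 0 := fun i =>
    (Submodule.mem_orthogonal _ _).1 hf _ (Submodule.subset_span ⟨i, rfl⟩)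
  set g : ℝ → ℂ := fun x : ℝ => (ENNReal.ofReal (w x)).toReal • f x with hg
  have hgi : Integrable g := by
    rw [hg, ← integrable_withDensity_iff_integrable_smul₀'
      hw.integrable.1.aemeasurable.ennreal_ofReal
      (Eventually.of_forall fun x => ENNReal.ofReal_lt_top)]
    exact (Lp.memLp f).integrable one_le_two
  -- Integrability of w f makes its transform continuous, so zeros on a dense set suffice.
  have hcont : Continuous (𝓕 g) :=
    VectorFourier.fourierIntegral_continuous (L := innerₗ ℝ) Real.continuous_fourierChar
      continuous_inner hgi
  have hzero : 𝓕 g = fun _ => 0 := by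
    refine hσ.equalizer hcont continuous_const (funext fun i => ?_)
    simp only [Function.comp_apply]
    rw [← inner_expL2_eq_fourier hw f, h1]
  have h2 := ae_eq_zero_of_fourier_eq_zero hgi fun t => congrFun hzero t
  rw [Lp.eq_zero_iff_ae_eq_zero]
  refine (withDensity_absolutelyContinuous volume _).ae_le ?_
  filter_upwards [h2, hw.pos] with x h3 h4
  have h5 : w x • f x = 0 := by
    simpa only [hg, ENNReal.toReal_ofReal h4.le, Pi.zero_apply] using h3
  exact (smul_eq_zero.1 h5).resolve_left h4.ne'

end Density

/-! ### Construction of the weight -/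

section Weight

theorem ae_of_ae_unitAddCircle {p : UnitAddCircle → Prop} (h : ∀ᵐ θ, p θ) :
    ∀ᵐ x : ℝ, p (x : UnitAddCircle) := by
  have h1 : ∀ n : ℤ, ∀ᵐ x : ℝ ∂volume.restrict (Set.Ioc (n : ℝ) (n + 1)), p (x : UnitAddCircle) :=
    fun n => (UnitAddCircle.measurePreserving_mk (n : ℝ)).quasiMeasurePreserving.ae h
  rw [← ae_restrict_iUnion_iff, iUnion_Ioc_intCast, Measure.restrict_univ] at h1
  exact h1

/-- A weight below the Gaussian that is as small as prescribed on the sets `F k`. -/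
theorem exists_isWeight_small {F : ℕ → Set UnitAddCircle} (hF : ∀ k, MeasurableSet (F k))
    (hsum : ∑' k, volume (F k) ≠ ⊤) (A : ℕ → ℝ) :
    ∃ w : ℝ → ℝ, IsWeight w ∧ (∀ x, 0 ≤ w x) ∧ (∀ x, w x ≤ Real.exp (-x ^ 2)) ∧
      ∀ k (x : ℝ), (x : UnitAddCircle) ∈ F k → A k * w x ≤ Real.exp (-x ^ 2) := by
  -- On F k this gives A k · v ≤ 1. By Borel–Cantelli almost every θ lies in finitely many F k, so
  -- the sum is finite and v is positive there.
  set v : UnitAddCircle → ENNReal := fun θ =>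
    (1 + ∑' k, (F k).indicator (fun _ => ENNReal.ofReal (A k)) θ)⁻¹ with hv
  have hvm : Measurable v := by
    have h1 : ∀ k, Measurable ((F k).indicator fun _ => ENNReal.ofReal (A k)) := fun k =>
      measurable_const.indicator (hF k)
    have h2 : Measurable fun θ => ∑' k, (F k).indicator (fun _ => ENNReal.ofReal (A k)) θ :=
      Measurable.tsum h1
    exact (h2.const_add 1).inv
  have hv1 : ∀ θ, v θ ≤ 1 := fun θ => by
    rw [hv, ENNReal.inv_le_one]; exact le_self_add
  have hvt : ∀ θ, v θ ≠ ⊤ := fun θ => ne_top_of_le_ne_top ENNReal.one_ne_top (hv1 θ)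
  have hv1' : ∀ θ, (v θ).toReal ≤ 1 := fun θ => by
    simpa using ENNReal.toReal_mono ENNReal.one_ne_top (hv1 θ)
  have hvpos : ∀ᵐ θ, 0 < (v θ).toReal := by
    filter_upwards [ae_eventually_notMem hsum] with θ hθ
    refine ENNReal.toReal_pos (ENNReal.inv_ne_zero.2 (ENNReal.add_ne_top.2
      ⟨ENNReal.one_ne_top, ?_⟩)) (hvt θ)
    obtain ⟨n, hn⟩ := eventually_atTop.1 hθ
    rw [tsum_eq_sum (s := Finset.range n) fun k hk =>
      Set.indicator_of_notMem (hn k (by simpa using hk)) _]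
    refine ENNReal.sum_ne_top.2 fun k _ => ?_
    by_cases h : θ ∈ F k <;> simp [h]
  have hm : Measurable fun x : ℝ => Real.exp (-x ^ 2) * (v (x : UnitAddCircle)).toReal := by
    have h1 : Measurable fun x : ℝ => (v (x : UnitAddCircle)).toReal :=
      (hvm.comp AddCircle.measurable_mk').ennreal_toReal
    exact Measurable.mul (by fun_prop) h1
  refine ⟨fun x => Real.exp (-x ^ 2) * (v (x : UnitAddCircle)).toReal, ⟨?_, ?_⟩, fun x => by positivity,
    fun x => mul_le_of_le_one_right (Real.exp_pos _).le (hv1' _), fun k x hx => ?_⟩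
  · refine isWeight_gaussian.integrable.mono' hm.aestronglyMeasurable (Eventually.of_forall fun x => ?_)
    rw [Real.norm_of_nonneg (by positivity)]
    exact mul_le_of_le_one_right (Real.exp_pos _).le (hv1' _)
  · filter_upwards [ae_of_ae_unitAddCircle hvpos] with x hx
    positivity
  · have h1 : ENNReal.ofReal (A k) * v (x : UnitAddCircle) ≤ 1 := by
      refine ENNReal.div_le_of_le_mul ?_
      rw [one_mul]
      calc ENNReal.ofReal (A k)
          = (F k).indicator (fun _ => ENNReal.ofReal (A k)) (x : UnitAddCircle) := by simp [hx]
        _ ≤ ∑' k, (F k).indicator (fun _ => ENNReal.ofReal (A k)) (x : UnitAddCircle) :=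
            ENNReal.le_tsum k
        _ ≤ _ := le_add_self
    have h2 : A k * (v (x : UnitAddCircle)).toReal ≤ 1 := by
      have h3 := ENNReal.toReal_mono ENNReal.one_ne_top h1
      rw [ENNReal.toReal_mul, ENNReal.toReal_one] at h3
      refine le_trans ?_ h3
      gcongr
      rw [ENNReal.toReal_ofReal']
      exact le_max_left _ _
    calc A k * (Real.exp (-x ^ 2) * (v (x : UnitAddCircle)).toReal)
        = Real.exp (-x ^ 2) * (A k * (v (x : UnitAddCircle)).toReal) := by ring
      _ ≤ Real.exp (-x ^ 2) := mul_le_of_le_one_right (Real.exp_pos _).le h2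

end Weight

/-! ### Approximation with small coefficients -/

section SmallCoefficients

variable {H : Type*} [NormedAddCommGroup H] [InnerProductSpace ℂ H] {u : ℕ → H}

/-- The vector `f` can be approximated by linear combinations of the tails of the system `u` with
arbitrarily small `ℓ_q` norm of the coefficients, for every `q > 2`. -/
def SmallCoeffApprox (u : ℕ → H) (f : H) : Prop :=
  ∀ q : ℝ, 2 < q → ∀ ε : ℝ, 0 < ε → ∀ η : ℝ, 0 < η → ∀ n₀ : ℕ, ∃ c : ℕ →₀ ℂ,
    (∀ n ∈ c.support, n₀ ≤ n) ∧ ‖f - c.sum fun n a => a • u n‖ < ε ∧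
      (c.sum fun _ a => ‖a‖ ^ q) < η

theorem SmallCoeffApprox.zero : SmallCoeffApprox u 0 := fun q _ ε hε η hη n₀ =>
  ⟨0, by simp, by simpa, by simpa⟩

/-- The second combination is taken beyond the support of the first, so the ℓ_q sums simply add.
This is why the definition asks for tails. -/
theorem SmallCoeffApprox.add {f g : H} (hf : SmallCoeffApprox u f) (hg : SmallCoeffApprox u g) :
    SmallCoeffApprox u (f + g) := by
  intro q hq ε hε η hη n₀
  obtain ⟨c, hc, hc1, hc2⟩ := hf q hq _ (half_pos hε) _ (half_pos hη) n₀
  obtain ⟨d, hd, hd1, hd2⟩ := hg q hq _ (half_pos hε) _ (half_pos hη) (max n₀ (c.support.sup id + 1))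
  have hdisj : Disjoint c.support d.support := Finset.disjoint_left.2 fun n hn hn' => by
    have h1 : n ≤ c.support.sup id := Finset.le_sup (f := id) hn
    have h2 := (le_max_right _ _).trans (hd n hn')
    omega
  refine ⟨c + d, fun n hn => ?_, ?_, ?_⟩
  · rcases Finset.mem_union.1 (Finsupp.support_add hn) with h | h
    · exact hc n h
    · exact (le_max_left _ _).trans (hd n h)
  · rw [Finsupp.sum_add_index_of_disjoint hdisj, add_sub_add_comm]
    refine (norm_add_le _ _).trans_lt ?_
    linarith
  · rw [Finsupp.sum_add_index_of_disjoint hdisj]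
    linarith

theorem SmallCoeffApprox.smul {f : H} (hf : SmallCoeffApprox u f) (a : ℂ) :
    SmallCoeffApprox u (a • f) := by
  rcases eq_or_ne a 0 with rfl | ha
  · rw [zero_smul]; exact SmallCoeffApprox.zero
  intro q hq ε hε η hη n₀
  have ha' : 0 < ‖a‖ := norm_pos_iff.2 ha
  have ha'' : 0 < ‖a‖ ^ q := by positivity
  obtain ⟨c, hc, hc1, hc2⟩ := hf q hq _ (div_pos hε ha') _ (div_pos hη ha'') n₀
  refine ⟨a • c, fun n hn => hc n (Finsupp.support_smul hn), ?_, ?_⟩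
  · rw [lt_div_iff₀ ha'] at hc1
    rw [Finsupp.sum_smul_index (h := fun n b => b • u n) fun _ => zero_smul _ _]
    have h1 : (c.sum fun n b => (a * b) • u n) = a • c.sum fun n b => b • u n := by
      rw [Finsupp.smul_sum]
      simp only [mul_smul]
    rwa [h1, ← smul_sub, norm_smul, mul_comm ‖a‖]
  · rw [lt_div_iff₀ ha''] at hc2
    rw [Finsupp.sum_smul_index (fun _ => by rw [norm_zero, Real.zero_rpow (by linarith)])]
    have h1 : (c.sum fun _ b => ‖a * b‖ ^ q) = (c.sum fun _ b => ‖b‖ ^ q) * ‖a‖ ^ q := by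
      rw [Finsupp.sum_mul]
      simp only [norm_mul, Real.mul_rpow (norm_nonneg _) (norm_nonneg _), mul_comm]
    rwa [h1]

theorem SmallCoeffApprox.of_mem_span {S : Set H} (hS : ∀ g ∈ S, SmallCoeffApprox u g) {f : H}
    (hf : f ∈ Submodule.span ℂ S) : SmallCoeffApprox u f := by
  induction hf using Submodule.span_induction with
  | mem g hg => exact hS g hg
  | zero => exact SmallCoeffApprox.zero
  | add f g _ _ hf hg => exact hf.add hg
  | smul a f _ hf => exact hf.smul a

theorem SmallCoeffApprox.of_dense_span {S : Set H} (hS : ∀ g ∈ S, SmallCoeffApprox u g)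
    (hdense : (Submodule.span ℂ S).topologicalClosure = ⊤) (f : H) : SmallCoeffApprox u f := by
  intro q hq ε hε η hη n₀
  have hf : f ∈ closure (Submodule.span ℂ S : Set H) := by
    rw [← Submodule.topologicalClosure_coe, hdense]
    trivial
  obtain ⟨g, hg, hfg⟩ := Metric.mem_closure_iff.1 hf _ (half_pos hε)
  obtain ⟨c, hc, hc1, hc2⟩ := SmallCoeffApprox.of_mem_span hS hg q hq _ (half_pos hε) η hη n₀
  refine ⟨c, hc, ?_, hc2⟩
  rw [dist_eq_norm] at hfg
  have := norm_sub_le_norm_sub_add_norm_sub f g (c.sum fun n a => a • u n)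
  linarith

/-- The choice η = ‖f‖^q gives the constant 1; as η must be positive, f = 0 is handled by the zero
combination. -/
theorem exists_approx_of_smallCoeffApprox (h : ∀ f, SmallCoeffApprox u f) {q : ℝ} (hq : 2 < q)
    (f : H) {ε : ℝ} (hε : 0 < ε) :
    ∃ c : ℕ →₀ ℂ, ‖f - ∑ n ∈ c.support, c n • u n‖ < ε ∧
      (∑ n ∈ c.support, ‖c n‖ ^ q) ^ (1 / q) ≤ 1 * ‖f‖ := by
  have hq0 : 0 < q := by linarith
  rcases eq_or_ne f 0 with rfl | hf
  · refine ⟨0, by simpa, ?_⟩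
    simp [Real.zero_rpow (inv_ne_zero hq0.ne')]
  · have hf' : 0 < ‖f‖ := norm_pos_iff.2 hf
    obtain ⟨c, -, hc1, hc2⟩ := h f q hq ε hε (‖f‖ ^ q) (by positivity) 0
    refine ⟨c, hc1, ?_⟩
    calc (∑ n ∈ c.support, ‖c n‖ ^ q) ^ (1 / q) ≤ (‖f‖ ^ q) ^ (1 / q) := by
          refine Real.rpow_le_rpow (Finset.sum_nonneg fun _ _ => by positivity) hc2.le (by positivity)
      _ = 1 * ‖f‖ := by
          rw [← Real.rpow_mul hf'.le, mul_one_div_cancel hq0.ne', Real.rpow_one, one_mul]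

end SmallCoefficients

/-! ### Approximating one exponential by one block -/

section Blocks

variable {w : ℝ → ℝ}

theorem norm_weightedL2_le (hw : IsWeight w) (hw0 : ∀ x, 0 ≤ w x) {f : WeightedL2 w} {g : ℝ → ℂ}
    (hfg : f =ᵐ[weightMeasure w] g) {δ : ℝ} (hδ : 0 ≤ δ)
    (hg : ∀ x, w x * ‖g x‖ ^ 2 ≤ δ ^ 2 * Real.exp (-x ^ 2)) :
    ‖f‖ ≤ δ * √(∫ x : ℝ, Real.exp (-x ^ 2)) := by
  have h1 : ‖f‖ ^ 2 = ∫ x, w x * ‖g x‖ ^ 2 := by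
    have h2 : ((‖f‖ ^ 2 : ℝ) : ℂ) = ((∫ x, ‖g x‖ ^ 2 ∂weightMeasure w : ℝ) : ℂ) := by
      have h3 := inner_self_eq_norm_sq_to_K (𝕜 := ℂ) f
      rw [L2.inner_def] at h3
      rw [← integral_complex_ofReal]
      push_cast
      refine Eq.trans h3.symm (integral_congr_ae ?_)
      filter_upwards [hfg] with x hx
      rw [hx, inner_self_eq_norm_sq_to_K]
      rfl
    rw [Complex.ofReal_inj.1 h2]
    refine (integral_withDensity_eq_integral_toReal_smul₀
      hw.integrable.1.aemeasurable.ennreal_ofReal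
      (Eventually.of_forall fun x => ENNReal.ofReal_lt_top) _).trans ?_
    simp only [ENNReal.toReal_ofReal (hw0 _), smul_eq_mul]
  have h4 : ‖f‖ ^ 2 ≤ δ ^ 2 * ∫ x : ℝ, Real.exp (-x ^ 2) := by
    rw [h1, ← integral_const_mul]
    refine integral_mono_of_nonneg (Eventually.of_forall fun x => ?_)
      (isWeight_gaussian.integrable.const_mul _) (Eventually.of_forall hg)
    have := hw0 x
    positivity
  refine Real.le_sqrt_of_sq_le h4 |>.trans_eq ?_
  rw [Real.sqrt_mul (by positivity), Real.sqrt_sq hδ]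

theorem eval_eq_sum_range_of_coeff_zero {P : Polynomial ℂ} (hP : P.coeff 0 = 0) (z : ℂ) :
    P.eval z = ∑ j ∈ Finset.range (P.natDegree + 1), P.coeff (j + 1) * z ^ (j + 1) := by
  rw [Polynomial.eval_eq_sum_range' (n := P.natDegree + 1 + 1) (by omega), Finset.sum_range_succ',
    hP, zero_mul, add_zero]

theorem sum_range_norm_coeff_rpow {P : Polynomial ℂ} (hP : P.coeff 0 = 0) {q : ℝ} (hq : q ≠ 0) :
    ∑ j ∈ Finset.range (P.natDegree + 1), ‖P.coeff (j + 1)‖ ^ q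
      = ∑ i ∈ P.support, ‖P.coeff i‖ ^ q := by
  have h1 : P.support ⊆ Finset.range (P.natDegree + 1 + 1) := fun i hi => by
    have := Polynomial.le_natDegree_of_mem_supp i hi
    exact Finset.mem_range.2 (by omega)
  rw [Finset.sum_subset h1 fun i _ hi => by
    rw [Polynomial.notMem_support_iff.1 hi, norm_zero, Real.zero_rpow hq], Finset.sum_range_succ' _ (P.natDegree + 1),
    hP, norm_zero, Real.zero_rpow hq, add_zero]

/-- L is an integer so that e^{2πiLx} descends to the circle; the real shift s enters only as a
unimodular factor. -/
theorem exp_mul_fourier_pow (s : ℝ) (L j : ℕ) (x : ℝ) :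
    Complex.exp (Complex.I * ((2 * Real.pi * (s + L * j) : ℝ) : ℂ) * x)
      = Complex.exp (Complex.I * ((2 * Real.pi * s : ℝ) : ℂ) * x)
        * fourier 1 (L • (x : UnitAddCircle)) ^ j := by
  rw [fourier_one_nsmul, ← pow_mul, fourier_coe_apply, ← Complex.exp_nat_mul, ← Complex.exp_add]
  congr 1
  push_cast
  ring

/-- The error of the approximation of an exponential by its product with `P (e ^ (2 π i L x))`. -/
theorem norm_expL2_sub_sum_le (hw : IsWeight w) (hw0 : ∀ x, 0 ≤ w x)
    (hle : ∀ x, w x ≤ Real.exp (-x ^ 2)) {P : Polynomial ℂ} (hP : P.coeff 0 = 0) {A δ : ℝ}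
    (hA : ∀ z : ℂ, ‖z‖ = 1 → ‖P.eval z‖ ≤ A) (hδ : 0 < δ) (s : ℝ) (L : ℕ)
    (hsmall : ∀ x : ℝ, δ < ‖P.eval (fourier 1 (L • (x : UnitAddCircle))) - 1‖ →
      ((A + 1) / δ) ^ 2 * w x ≤ Real.exp (-x ^ 2)) :
    ‖expL2 hw (2 * Real.pi * s) - ∑ j ∈ Finset.range (P.natDegree + 1),
      P.coeff (j + 1) • expL2 hw (2 * Real.pi * (s + L * ((j + 1 : ℕ) : ℝ)))‖
      ≤ δ * √(∫ x : ℝ, Real.exp (-x ^ 2)) := by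
  refine norm_weightedL2_le hw hw0 (g := fun x =>
    Complex.exp (Complex.I * ((2 * Real.pi * s : ℝ) : ℂ) * x) *
      (1 - P.eval (fourier 1 (L • (x : UnitAddCircle))))) ?_ hδ.le fun x => ?_
  · filter_upwards [Lp.coeFn_sub (expL2 hw (2 * Real.pi * s)) (∑ j ∈ Finset.range (P.natDegree + 1),
      P.coeff (j + 1) • expL2 hw (2 * Real.pi * (s + L * ((j + 1 : ℕ) : ℝ)))),
      coeFn_expL2 hw (2 * Real.pi * s),
      coeFn_sum_expL2 hw (Finset.range (P.natDegree + 1)) (fun j => P.coeff (j + 1))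
        fun j => 2 * Real.pi * (s + L * ((j + 1 : ℕ) : ℝ))] with x h1 h2 h3
    rw [h1, Pi.sub_apply, h2, h3, eval_eq_sum_range_of_coeff_zero hP, mul_sub, mul_one,
      Finset.mul_sum]
    congr 1
    refine Finset.sum_congr rfl fun j _ => ?_
    rw [exp_mul_fourier_pow]
    ring
  · have h1 : ‖Complex.exp (Complex.I * ((2 * Real.pi * s : ℝ) : ℂ) * x)‖ = 1 := by
      rw [Complex.norm_exp]; simp
    rw [norm_mul, h1, one_mul, norm_sub_rev]
    set t := ‖P.eval (fourier 1 (L • (x : UnitAddCircle))) - 1‖ with ht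
    have ht0 : 0 ≤ t := norm_nonneg _
    -- On the exceptional set the error is at most A + 1, which the damping factor ((A + 1)/δ)² of
    -- the weight compensates; elsewhere the error is at most δ and w is below the Gaussian.
    by_cases h : δ < t
    · have h2 := hsmall x h
      have h3 : t ≤ A + 1 := by
        refine (norm_sub_le _ _).trans ?_
        rw [norm_one]
        linarith [hA _ (norm_fourier_apply 1 (L • (x : UnitAddCircle)))]
      have h4 : w x * (A + 1) ^ 2 = δ ^ 2 * (((A + 1) / δ) ^ 2 * w x) := by
        field_simp
      calc w x * t ^ 2 ≤ w x * (A + 1) ^ 2 := by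
            have := hw0 x
            gcongr
        _ = δ ^ 2 * (((A + 1) / δ) ^ 2 * w x) := h4
        _ ≤ _ := by gcongr
    · have h2 := hle x
      rw [not_lt] at h
      rw [mul_comm]
      gcongr
      exact hw0 x

/-- The coefficients of a polynomial, placed in a block of indices. -/
theorem exists_finsupp_block (P : Polynomial ℂ) (N : ℕ) :
    ∃ c : ℕ →₀ ℂ, (∀ n ∈ c.support, N ≤ n) ∧
      (∀ {E : Type} [AddCommMonoid E] (g : ℕ → ℂ → E), (∀ n, g n 0 = 0) →
        c.sum g = ∑ j ∈ Finset.range (P.natDegree + 1), g (N + j) (P.coeff (j + 1))) := by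
  set f : ℕ → ℂ := fun n => if N ≤ n then P.coeff (n - N + 1) else 0 with hf
  have hsupp : ∀ n, f n ≠ 0 → n ∈ Finset.Ico N (N + (P.natDegree + 1)) := by
    intro n hn
    have h1 : N ≤ n := by
      by_contra h
      exact hn (if_neg h)
    have h2 : P.coeff (n - N + 1) ≠ 0 := by simpa only [hf, if_pos h1] using hn
    have := Polynomial.le_natDegree_of_ne_zero h2
    exact Finset.mem_Ico.2 (by omega)
  refine ⟨Finsupp.onFinset _ f hsupp, fun n hn => ?_, fun g hg => ?_⟩
  · exact (Finset.mem_Ico.1 (Finsupp.support_onFinset_subset hn)).1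
  · rw [Finsupp.onFinset_sum hsupp hg, Finset.sum_Ico_eq_sum_range, Nat.add_sub_cancel_left]
    refine Finset.sum_congr rfl fun j _ => ?_
    simp [hf]

end Blocks

/-! ### Assembly -/

theorem theorem3 (ε : ℕ → ℝ) (hε_pos : ∀ n, 0 < ε n) (hε_lim : Tendsto ε atTop (𝓝 0)) :
    ∃ (w : ℝ → ℝ) (hw : IsWeight w) (lam : ℕ → ℝ),
      (∀ n, 0 < lam n) ∧
      UniformlyDiscrete (Set.range lam) ∧
      (∀ n, lam (n + 1) / lam n > 1 + ε n) ∧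
      IsQFSystem (fun n => expL2 hw (lam n)) := by
  set σ : ℕ → ℝ := TopologicalSpace.denseSeq ℝ with hσ
  set δ : ℕ → ℝ := fun k => (1 / 2 : ℝ) ^ k with hδ
  have hδ0 : ∀ k, 0 < δ k := fun k => by positivity
  have hδ1 : ∀ k, δ k ≤ 1 := fun k => pow_le_one₀ (by norm_num) (by norm_num)
  have hδlim : Tendsto δ atTop (𝓝 0) :=
    tendsto_pow_atTop_nhds_zero_of_lt_one (by norm_num) (by norm_num)
  -- Exponents tending to 2: for each q > 2 all late polynomials have p k < q, so a single sequence
  -- serves every q.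
  set p : ℕ → ℝ := fun k => 2 + 1 / ((k : ℝ) + 1) with hp
  have hp2 : ∀ k, 2 < p k := fun k => lt_add_of_pos_right _ (by positivity)
  choose P hP0 hPc hPv using fun k => exists_polynomial_close_one_small_coeff (hp2 k) (hδ0 k)
  choose A hA1 hA using fun k => exists_norm_eval_le (P k)
  -- Unpairing k makes every σ i the base frequency of infinitely many blocks.
  obtain ⟨lam, N, L, hpos, hgap, hratio, hN, hL, hblock⟩ := exists_block_sequence ε hε_pos hε_lim
    (fun k => σ (Nat.unpair k).1) (fun k => (P k).natDegree + 1) (fun k => Nat.succ_pos _)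
  have hNge : ∀ k, k ≤ N k := (strictMono_nat_of_lt_succ fun k => by have := hN k; omega).id_le
  set F : ℕ → Set UnitAddCircle := fun k =>
    {θ | L k • θ ∈ {θ : UnitAddCircle | δ k < ‖(P k).eval (fourier 1 θ) - 1‖}} with hF
  have hEm : ∀ k, MeasurableSet {θ : UnitAddCircle | δ k < ‖(P k).eval (fourier 1 θ) - 1‖} :=
    fun k => by
      refine measurableSet_lt measurable_const (Continuous.measurable ?_)
      have := (P k).continuous
      fun_prop
  have hFm : ∀ k, MeasurableSet (F k) := fun k => (hEm k).preimage (by fun_prop)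
  have hFsum : ∑' k, volume (F k) ≠ ⊤ := by
    refine ne_top_of_le_ne_top (summable_geometric_two.tsum_ofReal_ne_top)
      (ENNReal.tsum_le_tsum fun k => ?_)
    rw [hF, volume_preimage_nsmul (hL k) (hEm k)]
    exact (hPv k).le
  obtain ⟨w, hw, hw0, hwle, hwsmall⟩ :=
    exists_isWeight_small hFm hFsum fun k => ((A k + 1) / δ k) ^ 2
  have hgap' : ∀ n, 2 * Real.pi * lam n + 1 ≤ 2 * Real.pi * lam (n + 1) := fun n => by
    have := hgap n
    have := Real.pi_gt_three
    nlinarith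
  have hπ : (0 : ℝ) < 2 * Real.pi := by positivity
  refine ⟨w, hw, fun n => 2 * Real.pi * lam n, fun n => mul_pos hπ (hpos n), ?_, fun n => ?_,
    fun q hq => ⟨1, fun f η hη => exists_approx_of_smallCoeffApprox (fun f => ?_) hq f hη⟩,
    exists_bessel_bound hw hwle hgap'⟩
  · refine ⟨1, one_pos, ?_⟩
    rintro _ ⟨m, rfl⟩ _ ⟨n, rfl⟩ hmn
    refine le_trans ?_ (abs_sub_le_abs_sub hgap' m n)
    have h1 : (m : ℤ) - n ≠ 0 := by
      rw [sub_ne_zero]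
      rintro h
      exact hmn (by rw [Nat.cast_injective h])
    exact_mod_cast Int.one_le_abs h1
  · rw [mul_div_mul_left _ _ hπ.ne', gt_iff_lt, lt_div_iff₀ (hpos n)]
    exact hratio n
  · refine SmallCoeffApprox.of_dense_span ?_
      (span_expL2_topologicalClosure_eq_top hw (TopologicalSpace.denseRange_denseSeq ℝ)) f
    rintro _ ⟨i, rfl⟩
    intro q hq ε' hε' η hη n₀
    set C₀ : ℝ := √(∫ x : ℝ, Real.exp (-x ^ 2)) with hC₀
    have hlim1 : Tendsto (fun k => δ k * C₀) atTop (𝓝 0) := by simpa using hδlim.mul_const C₀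
    have hlim2 : Tendsto p atTop (𝓝 2) := by
      simpa [hp] using tendsto_one_div_add_atTop_nhds_zero_nat.const_add (2 : ℝ)
    obtain ⟨k₀, hk₀⟩ := eventually_atTop.1 ((hlim1.eventually (gt_mem_nhds hε')).and
      ((hδlim.eventually (gt_mem_nhds hη)).and ((hlim2.eventually (gt_mem_nhds hq)).and
        (eventually_ge_atTop n₀))))
    -- A block that belongs to σ i and has index at least k₀.
    set k := Nat.pair i k₀ with hk
    obtain ⟨h1, h2, h3, h4⟩ := hk₀ k (Nat.right_le_pair i k₀)
    obtain ⟨c, hcs, hcsum⟩ := exists_finsupp_block (P k) (N k)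
    have hki : (Nat.unpair k).1 = i := by rw [hk, Nat.unpair_pair]
    refine ⟨c, fun n hn => (h4.trans (hNge k)).trans (hcs n hn), ?_, ?_⟩
    · rw [hcsum (fun n a => a • expL2 hw (2 * Real.pi * lam n)) fun n => zero_smul _ _]
      have h5 := norm_expL2_sub_sum_le hw hw0 hwle (hP0 k) (hA k) (hδ0 k) (σ i) (L k)
        fun x hx => hwsmall k x hx
      refine lt_of_le_of_lt (le_of_eq_of_le ?_ h5) h1
      congr 2
      refine Finset.sum_congr rfl fun j hj => ?_
      rw [hblock k j (Finset.mem_range.1 hj), hki]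
      push_cast
      rfl
    · have hq0 : q ≠ 0 := by linarith
      rw [hcsum (fun _ a => ‖a‖ ^ q) fun n => by rw [norm_zero, Real.zero_rpow hq0],
        sum_range_norm_coeff_rpow (hP0 k) hq0]
      refine lt_of_le_of_lt (Finset.sum_le_sum fun j hj => ?_) ((hPc k).trans h2)
      -- The sum of p k-th powers is below δ k ≤ 1, so each coefficient is at most 1 in modulus and
      -- raising the exponent to q only lowers the sum.
      refine Real.rpow_le_rpow_of_exponent_ge' (norm_nonneg _) ?_ (by linarith [hp2 k]) h3.le
      have h6 : ‖(P k).coeff j‖ ^ p k ≤ 1 :=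
        ((Finset.single_le_sum (f := fun i => ‖(P k).coeff i‖ ^ p k) (fun _ _ => by positivity)
          hj).trans (hPc k).le).trans (hδ1 k)
      by_contra! h7
      exact absurd (Real.one_lt_rpow h7 (by linarith [hp2 k])) h6.not_gt
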